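/- **Theorem 1 (bounds on the communication mutual information).** Consider the uplink MIMO-OFDM ISAC model with $N_c$ subcarriers, $N_x$ symbol intervals, $N_t$ transmit and $N_r\ge 1$ receive antennas, $$\mathbf Y(p)=\mathbf X(p)\mathbf H(p)+\mathbf X(p)\mathbf G(p)+\mathbf W(p),\qquad p=0,\dots,N_c-1,$$ in short $\mathbf Y=\mathbf X\mathbf H+\mathbf X\mathbf G+\mathbf W$, where $\mathbf X=\mathrm{diag}\{\mathbf X(p)\}\in\mathbb C^{N_cN_x\times N_cN_t}$ is random with square-integrable entries, and $\mathbf Y,\mathbf G,\mathbf W$ (and, in this equation, $\mathbf H$) are the stacks of their blocks. The channels are $\mathbf H(p)=\sum_{l=0}^{L_c}\mathbf H_le^{-j2\pi lp/N_c}$ and $\mathbf G(p)=\sum_{l=0}^{L_s}\mathbf G_le^{-j2\pi lp/N_c}$; the taps $\mathbf H_l\in\mathbb C^{N_t\times N_r}$ have an arbitrary joint law (they may be deterministic), and $\mathbf G_l=\mathbf R_{s,l}^{1/2}\mathbf G_{\omega,l}$ with $\mathbf R_{s,l}\in\mathbb C^{N_t\times N_t}$ positive semidefinite and the entries of $\mathbf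 G_{\omega,l}\in\mathbb C^{N_t\times N_r}$ independent (also over $l$) with law $\mathcal{CN}(0,\sigma_l^2)$. The entries of $\mathbf W$ are i.i.d. $\mathcal{CN}(0,\sigma_n^2)$ with $\sigma_n^2>0$. The families $(\mathbf H_l)_l$, $\mathbf X$, $(\mathbf G_{\omega,l})_l$ and $\mathbf W$ are mutually independent. Let $\Sigma_{\mathbf X}=E[\mathbf X^H\mathbf X]/N_x$; let $\Sigma_{\mathbf G}=E[\mathbf g\mathbf g^H]$, where $\mathbf g\in\mathbb C^{N_cN_t}$ is any column of the stacked matrix $\mathbf G$ (all columns have the same covariance); and let $$\mathbf R_{W_1}=\Big(\mathrm{tr}\big(E[\mathbf X^H\mathbf X]\,\Sigma_{\mathbf G}\big)/N_x+\sigma_n^2\Big)\mathbf I_{N_r}.$$ With $\bar{\mathbf H}=\mathrm{diag}\{\mathbf H(p)\}\in\mathbb C^{N_cN_t\times N_cN_r}$ put $$I_{\rm low}^{\rm com}=N_x\,E_{\mathbf H}\Big[\log_2\det\Big(\mathbf I_{N_rN_c}+\bar{\mathbf H}^H\Sigma_{\mathbf X}\bar{\mathbf H}\,(\mathbf I_{N_c}\otimes\mathbf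 R_{W_1}^{-1})\Big)\Big]\in[0,\infty],$$ $$I_{\rm high}^{\rm com}=I_{\rm low}^{\rm com}+N_x\log_2\det(\mathbf I_{N_c}\otimes\mathbf R_{W_1})-N_r\,E_{\mathbf X}\Big[\log_2\det\big(\mathbf X\Sigma_{\mathbf G}\mathbf X^H+\sigma_n^2\mathbf I_{N_xN_c}\big)\Big].$$ The last expectation is that of an integrable random variable, and the conditional mutual information (in bits) satisfies $$I(\mathbf X;\mathbf Y\mid\mathbf H)\le I_{\rm high}^{\rm com}.$$ If, moreover, the signalling is Gaussian, that is, the blocks $\mathbf X(p)$ are independent and the $N_x$ rows of each $\mathbf X(p)$ are i.i.d. circularly symmetric complex Gaussian vectors, then also $$I_{\rm low}^{\rm com}\le I(\mathbf X;\mathbf Y\mid\mathbf H).$$ -/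

import Mathlib

open MeasureTheory ProbabilityTheory InformationTheory
open scoped ENNReal NNReal Matrix Kronecker MatrixOrder ComplexOrder

noncomputable section

namespace UplinkISAC

/-! ### Circularly symmetric complex Gaussian laws -/

/-- The law `CN(0, v)` on `ℂ`: real and imaginary part are independent, centred, real Gaussians of
variance `v / 2` each. -/
def cscg (v : ℝ≥0) : Measure ℂ :=
  ((gaussianReal 0 (v / 2)).prod (gaussianReal 0 (v / 2))).map (fun z => (⟨z.1, z.2⟩ : ℂ))

/-- The law `CN(0, S)` on `ℂ^m`, for a positive semidefinite (possibly singular) covariance matrix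
`S`: the law of `S^{1/2} z`, where `z` has i.i.d. `CN(0, 1)` entries. -/
def cscgVector {m : ℕ} (S : Matrix (Fin m) (Fin m) ℂ) : Measure (Fin m → ℂ) :=
  (Measure.pi (fun _ : Fin m => cscg 1)).map (fun z => CFC.sqrt S *ᵥ z)

/-! ### Mutual information -/

/-- Conditional mutual information `I(X; Y | Z)` in nats: the average over the law of `Z` of the
Kullback-Leibler divergence of the conditional joint law of `(X, Y)` given `Z = z` from the product
of the conditional laws of `X` and of `Y` given `Z = z`. -/
def condMutualInfo {Ω α β γ : Type*} [MeasurableSpace Ω]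
    [MeasurableSpace α] [StandardBorelSpace α] [Nonempty α]
    [MeasurableSpace β] [StandardBorelSpace β] [Nonempty β] [MeasurableSpace γ]
    (μ : Measure Ω) [IsFiniteMeasure μ] (X : Ω → α) (Y : Ω → β) (Z : Ω → γ) : ℝ≥0∞ :=
  ∫⁻ z, klDiv (condDistrib (fun ω => (X ω, Y ω)) Z μ z)
    ((condDistrib X Z μ z).prod (condDistrib Y Z μ z)) ∂(μ.map Z)

/-- Conditional mutual information `I(X; Y | Z)` in bits. -/
def condMutualInfoBits {Ω α β γ : Type*} [MeasurableSpace Ω]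
    [MeasurableSpace α] [StandardBorelSpace α] [Nonempty α]
    [MeasurableSpace β] [StandardBorelSpace β] [Nonempty β] [MeasurableSpace γ]
    (μ : Measure Ω) [IsFiniteMeasure μ] (X : Ω → α) (Y : Ω → β) (Z : Ω → γ) : ℝ≥0∞ :=
  condMutualInfo μ X Y Z / ENNReal.ofReal (Real.log 2)

/-! ### Block matrices and channels

A family of `Nc` matrices, one per subcarrier, is a function `Fin Nc → Fin m → Fin n → ℂ`. -/

instance standardBorelSpace_blocks {Nc m n : ℕ} :
    StandardBorelSpace (Fin Nc → Fin m → Fin n → ℂ) :=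
  haveI : StandardBorelSpace (Fin m → Fin n → ℂ) := inferInstance
  StandardBorelSpace.pi_countable

/-- `diag{M(0), …, M(Nc - 1)}`. -/
def blkDiag {Nc m n : ℕ} (M : Fin Nc → Fin m → Fin n → ℂ) :
    Matrix (Fin Nc × Fin m) (Fin Nc × Fin n) ℂ :=
  (Matrix.blockDiagonal (fun p => Matrix.of (M p))).submatrix Prod.swap Prod.swap

/-- Frequency response `∑ₗ Mₗ exp(-j (2π / Nc) l p)` at the subcarriers `p` of a channel with the
tap matrices `Mₗ`, `l = 0, …, L`. -/
def freqResponse {L m n : ℕ} (Nc : ℕ) (taps : Fin (L + 1) → Fin m → Fin n → ℂ) :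
    Fin Nc → Fin m → Fin n → ℂ :=
  fun p i j => ∑ l : Fin (L + 1),
    taps l i j * Complex.exp (-Complex.I * (2 * Real.pi / (Nc : ℂ)) * ((l : ℕ) : ℂ) * ((p : ℕ) : ℂ))

/-- Sensing channel taps `Gₗ = R_{s,l}^{1/2} G_{ω,l}`. -/
def correlatedTaps {L Nt Nr : ℕ} (Rs : Fin (L + 1) → Matrix (Fin Nt) (Fin Nt) ℂ)
    (Gw : Fin (L + 1) → Fin Nt → Fin Nr → ℂ) : Fin (L + 1) → Fin Nt → Fin Nr → ℂ :=
  fun l => CFC.sqrt (Rs l) * Matrix.of (Gw l)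

/-- Received signal `Y = X H + X G + W`; `X` and `W` are given by their blocks, `H` and `G` by their
frequency responses, and the block of `Y` at the subcarrier `p` is
`X(p) H(p) + X(p) G(p) + W(p)`. -/
def received {Nc Nx Nt Nr : ℕ} (X : Fin Nc → Fin Nx → Fin Nt → ℂ)
    (H G : Fin Nc → Fin Nt → Fin Nr → ℂ) (W : Fin Nc → Fin Nx → Fin Nr → ℂ) :
    Fin Nc → Fin Nx → Fin Nr → ℂ :=
  fun p => Matrix.of (X p) * Matrix.of (H p) + Matrix.of (X p) * Matrix.of (G p)
    + Matrix.of (W p)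

/-! ### Second-order statistics -/

variable {Ω : Type*} [MeasurableSpace Ω]

/-- `E[Xᴴ X]`, where `X` is the block diagonal transmit matrix. -/
def txGram {Nc Nx Nt : ℕ} (μ : Measure Ω) (X : Ω → Fin Nc → Fin Nx → Fin Nt → ℂ) :
    Matrix (Fin Nc × Fin Nt) (Fin Nc × Fin Nt) ℂ :=
  Matrix.of fun a b => ∫ ω, ((blkDiag (X ω))ᴴ * blkDiag (X ω)) a b ∂μ

/-- `Σ_X = E[Xᴴ X] / N_x`. -/
def sigmaX {Nc Nx Nt : ℕ} (μ : Measure Ω) (X : Ω → Fin Nc → Fin Nx → Fin Nt → ℂ) :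
    Matrix (Fin Nc × Fin Nt) (Fin Nc × Fin Nt) ℂ :=
  (Nx : ℂ)⁻¹ • txGram μ X

/-- `E[g gᴴ]`, where `g` is the column with the index `ν` of the channel matrix
`[G(0)ᵀ, …, G(Nc - 1)ᵀ]ᵀ`. -/
def sigmaG {Nc Nt Nr : ℕ} (μ : Measure Ω) (G : Ω → Fin Nc → Fin Nt → Fin Nr → ℂ) (ν : Fin Nr) :
    Matrix (Fin Nc × Fin Nt) (Fin Nc × Fin Nt) ℂ :=
  Matrix.of fun a b => ∫ ω, G ω a.1 a.2 ν * star (G ω b.1 b.2 ν) ∂μ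

/-- `R_{W₁} = (tr(E[Xᴴ X] Σ_G) / N_x + σ_n²) I`. -/
def interferenceCov {Nc Nx Nt : ℕ} (Nr : ℕ) (μ : Measure Ω) (X : Ω → Fin Nc → Fin Nx → Fin Nt → ℂ)
    (SG : Matrix (Fin Nc × Fin Nt) (Fin Nc × Fin Nt) ℂ) (σ2 : ℝ≥0) :
    Matrix (Fin Nr) (Fin Nr) ℂ :=
  ((txGram μ X * SG).trace / (Nx : ℂ) + ((σ2 : ℝ) : ℂ)) • 1

/-! ### The model -/

/-- Gaussian signalling: the blocks `X(0), …, X(Nc - 1)` are independent, and the `N_x` rows of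
`X(p)` (one per symbol interval) are i.i.d. circularly symmetric complex Gaussian vectors. -/
def IsGaussianSignal {Nc Nx Nt : ℕ} (μ : Measure Ω) (X : Ω → Fin Nc → Fin Nx → Fin Nt → ℂ) :
    Prop :=
  ∃ S : Fin Nc → Matrix (Fin Nt) (Fin Nt) ℂ, (∀ p, (S p).PosSemidef) ∧
    HasLaw X (Measure.pi fun p => Measure.pi fun _ : Fin Nx => cscgVector (S p)) μ

/-- The random objects of the uplink MIMO-OFDM model: the transmit blocks `X`, the communication
channel taps `h`, the uncorrelated sensing channel taps `Gw` with the tap variances `τ2 l`, and the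
noise `W` with the variance `σ2`. -/
structure IsModel {Nc Nx Nt Nr Lc Ls : ℕ} (μ : Measure Ω)
    (X : Ω → Fin Nc → Fin Nx → Fin Nt → ℂ) (h : Ω → Fin (Lc + 1) → Fin Nt → Fin Nr → ℂ)
    (Gw : Ω → Fin (Ls + 1) → Fin Nt → Fin Nr → ℂ) (W : Ω → Fin Nc → Fin Nx → Fin Nr → ℂ)
    (τ2 : Fin (Ls + 1) → ℝ≥0) (σ2 : ℝ≥0) : Prop where
  measurable_X : Measurable X
  measurable_h : Measurable h
  /-- The transmitted signal has finite power. -/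
  memLp_X : ∀ p n t, MemLp (fun ω => X ω p n t) 2 μ
  /-- The entries of the matrices `G_{ω,l}` are independent, with the law `CN(0, τ2 l)`. -/
  law_Gw : HasLaw Gw
    (Measure.pi fun l => Measure.pi fun _ : Fin Nt => Measure.pi fun _ : Fin Nr => cscg (τ2 l)) μ
  /-- The entries of the noise are i.i.d. with the law `CN(0, σ2)`. -/
  law_W : HasLaw W
    (Measure.pi fun _ : Fin Nc => Measure.pi fun _ : Fin Nx =>
      Measure.pi fun _ : Fin Nr => cscg σ2) μ
  /-- With the next two: `h`, `X`, `Gw`, `W` are mutually independent. -/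
  indep_h : IndepFun h (fun ω => (X ω, Gw ω, W ω)) μ
  indep_X : IndepFun X (fun ω => (Gw ω, W ω)) μ
  indep_Gw : IndepFun Gw W μ

/-! ### The bounds -/

/-- The lower bound for a given `H`:
`N_x log₂ det(I + Hᴴ Σ_X H (I ⊗ R_{W₁}⁻¹))` with `H = diag{H(p)}`. The determinant is a real
number, at least `1`, when `Σ_X` is positive semidefinite and `R` a positive multiple of `I`. -/
def lowRate {Nc Nt Nr : ℕ} (Nx : ℕ) (H : Fin Nc → Fin Nt → Fin Nr → ℂ)
    (SX : Matrix (Fin Nc × Fin Nt) (Fin Nc × Fin Nt) ℂ) (R : Matrix (Fin Nr) (Fin Nr) ℂ) : ℝ :=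
  Nx * Real.logb 2
    (1 + (blkDiag H)ᴴ * SX * blkDiag H * ((1 : Matrix (Fin Nc) (Fin Nc) ℂ) ⊗ₖ R⁻¹)).det.re

/-- `log₂ det(X Σ_G Xᴴ + σ_n² I)` for a given block diagonal `X`; the determinant is a positive real
number when `Σ_G` is positive semidefinite and `σ_n² > 0`. -/
def condLogDet {Nc Nx Nt : ℕ} (X : Fin Nc → Fin Nx → Fin Nt → ℂ)
    (SG : Matrix (Fin Nc × Fin Nt) (Fin Nc × Fin Nt) ℂ) (σ2 : ℝ≥0) : ℝ :=
  Real.logb 2 (blkDiag X * SG * (blkDiag X)ᴴ + ((σ2 : ℝ) : ℂ) • 1).det.re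

end UplinkISAC

end

open UplinkISAC

/-!
# Bounds on the communication mutual information of an uplink MIMO-OFDM ISAC system

Since `H` is independent of the other signals, conditioning on it amounts to fixing its value, and
`I(X; Y | H)` is an average over `H` of the mutual information of a channel with a fixed `H`
(`condMutualInfo_of_indepFun`, `IsModel.condMutualInfo_eq`). For such a channel, `Y` has, given
`X = x`, a Gaussian density: its columns are independent, with the covariance matrix
`K_x = x Σ_G xᴴ + σ²` (`map_channelOutput_eq_withDensity`). Let `ρ = tr(E[Xᴴ X] Σ_G) / Nx + σ²`.
Both bounds compare `Y` with the output of the channel `y = X H + noise` with white Gaussian noise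
of the variance `ρ` and Gaussian `X` of the covariance `Σ_X`. The blocks and rows of this output are
independent, and at the subcarrier `p` they have the covariance matrix
`B_p = H(p)ᵀ A_p H(p)ᵀᴴ + ρ` (`outputCov`), where `A_pᵀ` is the diagonal block of `Σ_X`; its density
is `comparisonDens`.

*Upper bound* (`klDiv_jointLaw_le`). Replacing the law of `Y` in `KL(P_XY ‖ P_X ⊗ P_Y)` by any other
law can only increase the divergence (`klDiv_fst_prod_snd_le`). With the comparison law, the
log-likelihood ratio consists of log-determinants and quadratic forms. The form that belongs to
`K_x` averages to the dimension `Nr Nc Nx`. That of `B_p` averages to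
`Nx Nr - (Nx ρ - η_p) tr B_p⁻¹`, where `η_p` is the interference and noise power at the subcarrier
`p`; as `η_p ≤ Nx ρ`, this is at most `Nx Nr`. What remains is
`Nx ∑ log det B_p - Nr E[log det K_X]`, the upper bound.

*Lower bound* (`le_klDiv_jointLaw`). The Donsker-Varadhan inequality (`ofReal_integral_le_klDiv`) is
applied to the log-likelihood ratio `f` of the comparison channel. For Gaussian signals
`E[exp f] = 1` under `P_X ⊗ P_Y`, because the comparison law is then the output law of that channel
(`lintegral_comparisonDens_sub`). The expectation of `f` under the true joint law is
`Nx ∑ (log det B_p - Nr log ρ) + ∑ (Nx ρ - η_p) (Nr / ρ - tr B_p⁻¹)`, and the last sum is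
nonnegative since `B_p ≥ ρ`.

Expectations of quadratic forms only involve second moments, for which `HasMoment` and `HasCov`
provide a small calculus. The rate `lowRate` is `Nx ∑ (log₂ det B_p - Nr log₂ ρ)` because its matrix
is block diagonal (`lowRate_eq`). Degenerate sizes are included: for `Nx = 0` or `Nc = 0` both
bounds vanish.
-/

open UplinkISAC

noncomputable section

namespace UplinkISAC

/-! ### Complex Gaussian densities -/

section GaussianDensity

variable {ι κ : Type*} [Fintype ι] [Fintype κ]

/-- The real part of `yᴴ N y`; for a Hermitian `N` the whole number is real. -/
def quadForm (N : Matrix ι ι ℂ) (y : ι → ℂ) : ℝ := (star y ⬝ᵥ N *ᵥ y).re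

lemma quadForm_nonneg {N : Matrix ι ι ℂ} (hN : N.PosSemidef) (y : ι → ℂ) : 0 ≤ quadForm N y :=
  (Complex.nonneg_iff.1 (hN.dotProduct_mulVec_nonneg y)).1

lemma re_star_dotProduct_self (y : ι → ℂ) : (star y ⬝ᵥ y).re = ∑ i, ‖y i‖ ^ 2 := by
  simp only [dotProduct, Pi.star_apply, Complex.re_sum]
  refine Finset.sum_congr rfl fun i _ => ?_
  rw [RCLike.star_def, Complex.conj_mul']
  norm_cast

lemma quadForm_conjTranspose_mul_self (B : Matrix κ ι ℂ) (y : ι → ℂ) :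
    quadForm (Bᴴ * B) y = ∑ i, ‖(B *ᵥ y) i‖ ^ 2 := by
  rw [quadForm, ← re_star_dotProduct_self, Matrix.star_mulVec, ← Matrix.mulVec_mulVec,
    Matrix.dotProduct_mulVec]

lemma continuous_quadForm (N : Matrix ι ι ℂ) : Continuous (quadForm N) := by
  unfold quadForm dotProduct Matrix.mulVec dotProduct
  fun_prop

variable [DecidableEq ι]

lemma quadForm_smul_one (c : ℝ) (y : ι → ℂ) :
    quadForm ((c : ℂ) • (1 : Matrix ι ι ℂ)) y = c * ∑ i, ‖y i‖ ^ 2 := by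
  rw [quadForm, Matrix.smul_mulVec, Matrix.one_mulVec, dotProduct_smul, smul_eq_mul,
    Complex.re_ofReal_mul, re_star_dotProduct_self]

lemma _root_.Matrix.PosDef.det_re_pos {K : Matrix ι ι ℂ} (hK : K.PosDef) : 0 < K.det.re :=
  (Complex.pos_iff.1 hK.det_pos).1

lemma _root_.Matrix.PosDef.coe_det_re {K : Matrix ι ι ℂ} (hK : K.PosDef) :
    ((K.det.re : ℝ) : ℂ) = K.det :=
  Complex.ext rfl (Complex.pos_iff.1 hK.det_pos).2

lemma _root_.Matrix.PosDef.exists_conjTranspose_mul_self {K : Matrix ι ι ℂ} (hK : K.PosDef) :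
    ∃ B : Matrix ι ι ℂ, Bᴴ * B = K ∧ IsUnit B := by
  have h0 : (0 : Matrix ι ι ℂ) ≤ K := hK.posSemidef.nonneg
  have hs : (CFC.sqrt K).PosSemidef := Matrix.nonneg_iff_posSemidef.1 (CFC.sqrt_nonneg K)
  have hm : CFC.sqrt K * CFC.sqrt K = K := CFC.sqrt_mul_sqrt_self K h0
  refine ⟨CFC.sqrt K, by rw [hs.isHermitian.eq, hm], ?_⟩
  have hu := hK.isUnit
  rw [← hm, Matrix.isUnit_iff_isUnit_det, Matrix.det_mul] at hu
  exact (Matrix.isUnit_iff_isUnit_det _).2 (isUnit_of_mul_isUnit_left hu)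

lemma integral_exp_neg_sq_norm_complex : ∫ z : ℂ, Real.exp (-‖z‖ ^ 2) = Real.pi := by
  have h := GaussianFourier.integral_rexp_neg_mul_sq_norm (V := ℂ) one_pos
  simpa using h

omit [DecidableEq ι] in
lemma integral_exp_neg_sum_sq_norm :
    ∫ y : ι → ℂ, Real.exp (-∑ i, ‖y i‖ ^ 2) = Real.pi ^ Fintype.card ι := by
  simp_rw [← Finset.sum_neg_distrib, Real.exp_sum]
  rw [integral_fintype_prod_volume_eq_pow fun z : ℂ => Real.exp (-‖z‖ ^ 2),
    integral_exp_neg_sq_norm_complex]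

/-- The Gaussian integral on `ℂ^n`. A factorization `K = Bᴴ B` reduces it to `K = 1`; the real
Jacobian of the complex linear map `B` is `|det B|² = det K`. -/
lemma integral_exp_neg_quadForm {K : Matrix ι ι ℂ} (hK : K.PosDef) :
    ∫ y : ι → ℂ, Real.exp (-quadForm K y) = Real.pi ^ Fintype.card ι / K.det.re := by
  obtain ⟨B, rfl, hB⟩ := hK.exists_conjTranspose_mul_self
  have hdB : B.det ≠ 0 := ((Matrix.isUnit_iff_isUnit_det _).1 hB).ne_zero
  have hdet : (Bᴴ * B).det.re = Complex.normSq B.det := by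
    rw [Matrix.det_mul, Matrix.det_conjTranspose, RCLike.star_def,
      ← Complex.normSq_eq_conj_mul_self]
    simp
  set L : (ι → ℂ) →ₗ[ℝ] (ι → ℂ) := (Matrix.toLin' B).restrictScalars ℝ with hL
  have hLdet : LinearMap.det L = Complex.normSq B.det := by
    rw [hL, LinearMap.det_restrictScalars, LinearMap.det_toLin', Algebra.norm_complex_apply]
  have hpos : 0 < Complex.normSq B.det := Complex.normSq_pos.2 hdB
  have hmap := Measure.map_linearMap_addHaar_eq_smul_addHaar (volume : Measure (ι → ℂ))
    (f := L) (by rw [hLdet]; exact hpos.ne')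
  have hcont : Continuous L := L.continuous_of_finiteDimensional
  have h1 : ∫ y : ι → ℂ, Real.exp (-quadForm (Bᴴ * B) y)
      = ∫ y, Real.exp (-∑ i, ‖y i‖ ^ 2) ∂(Measure.map L volume) := by
    rw [integral_map hcont.measurable.aemeasurable
      (Continuous.aestronglyMeasurable (by fun_prop))]
    refine integral_congr_ae (.of_forall fun y => ?_)
    simp only [quadForm_conjTranspose_mul_self]
    rfl
  rw [h1, hmap, integral_smul_measure, integral_exp_neg_sum_sq_norm, hLdet, hdet,
    abs_of_pos (inv_pos.2 hpos), ENNReal.toReal_ofReal (inv_pos.2 hpos).le, smul_eq_mul]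
  ring

lemma integrable_exp_neg_quadForm {K : Matrix ι ι ℂ} (hK : K.PosDef) :
    Integrable fun y : ι → ℂ => Real.exp (-quadForm K y) :=
  .of_integral_ne_zero (by
    rw [integral_exp_neg_quadForm hK]
    exact div_ne_zero (pow_ne_zero _ Real.pi_ne_zero) hK.det_re_pos.ne')

/-- The density of `CN(0, K)` on `ℂ^n` with respect to Lebesgue measure, for a positive definite
covariance matrix `K`. -/
def gaussDens (K : Matrix ι ι ℂ) (y : ι → ℂ) : ℝ :=
  (Real.pi ^ Fintype.card ι * K.det.re)⁻¹ * Real.exp (-quadForm K⁻¹ y)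

lemma continuous_gaussDens (K : Matrix ι ι ℂ) : Continuous (gaussDens K) := by
  have := continuous_quadForm K⁻¹
  unfold gaussDens
  fun_prop

lemma gaussDens_pos {K : Matrix ι ι ℂ} (hK : K.PosDef) (y : ι → ℂ) : 0 < gaussDens K y := by
  have := hK.det_re_pos
  unfold gaussDens
  positivity

lemma log_gaussDens {K : Matrix ι ι ℂ} (hK : K.PosDef) (y : ι → ℂ) :
    Real.log (gaussDens K y)
      = -(Fintype.card ι * Real.log Real.pi) - Real.log K.det.re - quadForm K⁻¹ y := by
  have h := hK.det_re_pos
  rw [gaussDens, Real.log_mul (by positivity) (Real.exp_pos _).ne', Real.log_inv, Real.log_exp,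
    Real.log_mul (by positivity) h.ne', Real.log_pow]
  ring

lemma det_inv_re {K : Matrix ι ι ℂ} (hK : K.PosDef) : K⁻¹.det.re = K.det.re⁻¹ := by
  rw [Matrix.det_nonsing_inv, Ring.inverse_eq_inv', ← hK.coe_det_re, ← Complex.ofReal_inv,
    Complex.ofReal_re, Complex.ofReal_re]

lemma integral_gaussDens {K : Matrix ι ι ℂ} (hK : K.PosDef) :
    ∫ y : ι → ℂ, gaussDens K y = 1 := by
  have h := hK.det_re_pos
  simp only [gaussDens]
  rw [integral_const_mul, integral_exp_neg_quadForm hK.inv, det_inv_re hK]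
  field_simp

lemma integrable_gaussDens {K : Matrix ι ι ℂ} (hK : K.PosDef) :
    Integrable fun y : ι → ℂ => gaussDens K y :=
  (integrable_exp_neg_quadForm hK.inv).const_mul _

omit [Fintype ι] in
lemma posDef_smul_one {s : ℝ} (hs : 0 < s) : ((s : ℂ) • (1 : Matrix ι ι ℂ)).PosDef :=
  Matrix.PosDef.one.smul (by exact_mod_cast hs)

omit [Fintype ι] in
lemma _root_.Matrix.PosSemidef.add_smul_one_posDef {A : Matrix ι ι ℂ} (hA : A.PosSemidef) {s : ℝ}
    (hs : 0 < s) : (A + (s : ℂ) • (1 : Matrix ι ι ℂ)).PosDef :=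
  Matrix.PosDef.posSemidef_add hA (posDef_smul_one hs)

lemma gaussDens_smul_one {s : ℝ} (hs : 0 < s) (y : ι → ℂ) :
    gaussDens ((s : ℂ) • (1 : Matrix ι ι ℂ)) y
      = ∏ i, (Real.pi * s)⁻¹ * Real.exp (-(‖y i‖ ^ 2 / s)) := by
  have hinv : ((s : ℂ) • (1 : Matrix ι ι ℂ))⁻¹ = ((s⁻¹ : ℝ) : ℂ) • (1 : Matrix ι ι ℂ) := by
    refine Matrix.inv_eq_left_inv ?_
    rw [Matrix.smul_mul, Matrix.one_mul, smul_smul]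
    have : (s : ℂ) ≠ 0 := by exact_mod_cast hs.ne'
    push_cast
    rw [inv_mul_cancel₀ this, one_smul]
  have hdet : ((s : ℂ) • (1 : Matrix ι ι ℂ)).det.re = s ^ Fintype.card ι := by
    rw [Matrix.det_smul, Matrix.det_one, mul_one, ← Complex.ofReal_pow, Complex.ofReal_re]
  rw [gaussDens, hinv, hdet, quadForm_smul_one, Finset.prod_mul_distrib, Finset.prod_const,
    Finset.card_univ, ← Real.exp_sum, Finset.sum_neg_distrib, ← Finset.sum_div, ← mul_pow, inv_pow,
    div_eq_inv_mul]

variable [DecidableEq κ]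

/-- Completing the square: with `B = M Mᴴ + s`, the exponent of the joint density of `z` and of
`M z + √s w` splits into that of the law `CN(0, B)` and a quadratic form in `z - Mᴴ B⁻¹ y`. -/
lemma sum_sq_add_sum_sq_sub_mulVec (M : Matrix ι κ ℂ) {s : ℝ} (hs : 0 < s) (y : ι → ℂ)
    (v : κ → ℂ) :
    ∑ j, ‖(v + Mᴴ *ᵥ ((M * Mᴴ + (s : ℂ) • 1)⁻¹ *ᵥ y)) j‖ ^ 2
        + (∑ i, ‖(y - M *ᵥ (v + Mᴴ *ᵥ ((M * Mᴴ + (s : ℂ) • 1)⁻¹ *ᵥ y))) i‖ ^ 2) / s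
      = quadForm (M * Mᴴ + (s : ℂ) • 1)⁻¹ y + quadForm (1 + (s⁻¹ : ℂ) • (Mᴴ * M)) v := by
  have hB : (M * Mᴴ + (s : ℂ) • (1 : Matrix ι ι ℂ)).PosDef :=
    (Matrix.posSemidef_self_mul_conjTranspose M).add_smul_one_posDef hs
  set B := M * Mᴴ + (s : ℂ) • (1 : Matrix ι ι ℂ) with hBdef
  obtain ⟨u, hu⟩ : ∃ u, u = B⁻¹ *ᵥ y := ⟨_, rfl⟩
  rw [← hu]
  have hs' : (s : ℂ) ≠ 0 := by exact_mod_cast hs.ne'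
  have hy : y = B *ᵥ u := by
    rw [hu, Matrix.mulVec_mulVec, Matrix.mul_nonsing_inv _ ((Matrix.isUnit_iff_isUnit_det _).1
      hB.isUnit), Matrix.one_mulVec]
  have hsub : y - M *ᵥ (v + Mᴴ *ᵥ u) = (s : ℂ) • u - M *ᵥ v := by
    rw [hy, hBdef, Matrix.add_mulVec, Matrix.smul_mulVec, Matrix.one_mulVec, Matrix.mulVec_add,
      Matrix.mulVec_mulVec]
    abel
  have hstar : star (Mᴴ *ᵥ u) = star u ᵥ* M := by
    rw [Matrix.star_mulVec, Matrix.conjTranspose_conjTranspose]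
  rw [hsub, ← re_star_dotProduct_self, ← re_star_dotProduct_self, quadForm, quadForm]
  have hcr : (star v ⬝ᵥ (Mᴴ *ᵥ u)).re = (star u ⬝ᵥ (M *ᵥ v)).re := by
    have : star v ⬝ᵥ (Mᴴ *ᵥ u) = star (star u ⬝ᵥ (M *ᵥ v)) := by
      rw [Matrix.star_dotProduct, hstar, ← Matrix.dotProduct_mulVec]
    rw [this, RCLike.star_def, Complex.conj_re]
  have h1 : star y ⬝ᵥ u = star (Mᴴ *ᵥ u) ⬝ᵥ (Mᴴ *ᵥ u) + (s : ℂ) * (star u ⬝ᵥ u) := by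
    rw [hy, Matrix.star_mulVec, hB.isHermitian.eq, ← Matrix.dotProduct_mulVec, hBdef,
      Matrix.add_mulVec, Matrix.smul_mulVec, Matrix.one_mulVec, dotProduct_add, dotProduct_smul,
      hstar, ← Matrix.dotProduct_mulVec, Matrix.mulVec_mulVec, smul_eq_mul]
  have h2 : star v ⬝ᵥ ((1 + (s⁻¹ : ℂ) • (Mᴴ * M)) *ᵥ v)
      = star v ⬝ᵥ v + (s⁻¹ : ℂ) * (star (M *ᵥ v) ⬝ᵥ (M *ᵥ v)) := by
    rw [Matrix.add_mulVec, Matrix.smul_mulVec, Matrix.one_mulVec, dotProduct_add, dotProduct_smul,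
      ← Matrix.mulVec_mulVec, Matrix.star_mulVec, ← Matrix.dotProduct_mulVec, smul_eq_mul]
  have h3 : star (Mᴴ *ᵥ u) ⬝ᵥ v = star u ⬝ᵥ (M *ᵥ v) := by
    rw [hstar, ← Matrix.dotProduct_mulVec]
  have h4 : (star (M *ᵥ v) ⬝ᵥ u).re = (star u ⬝ᵥ (M *ᵥ v)).re := by
    have : star (M *ᵥ v) ⬝ᵥ u = star (star u ⬝ᵥ (M *ᵥ v)) := by
      rw [Matrix.star_dotProduct]
    rw [this, RCLike.star_def, Complex.conj_re]
  rw [← hu, h1, h2]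
  have e1 : (s⁻¹ : ℂ) = ((s⁻¹ : ℝ) : ℂ) := by push_cast; rfl
  simp only [star_add, star_sub, star_smul, add_dotProduct, dotProduct_add, sub_dotProduct,
    dotProduct_sub, smul_dotProduct, dotProduct_smul, Complex.add_re, Complex.sub_re, h3, hcr,
    smul_eq_mul, RCLike.star_def, Complex.conj_ofReal, e1, Complex.re_ofReal_mul, h4]
  field_simp
  ring

end GaussianDensity

end UplinkISAC

namespace UplinkISAC

/-! ### Products of laws with densities -/

section Product

lemma pi_withDensity_ofReal {ι : Type*} [Fintype ι] {E : ι → Type*} [∀ i, MeasurableSpace (E i)]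
    (μ : ∀ i, Measure (E i)) [∀ i, SigmaFinite (μ i)] {f : ∀ i, E i → ℝ}
    (hf0 : ∀ i x, 0 ≤ f i x) (hf : ∀ i, Integrable (f i) (μ i)) :
    Measure.pi (fun i => (μ i).withDensity fun x => ENNReal.ofReal (f i x))
      = (Measure.pi μ).withDensity fun x => ENNReal.ofReal (∏ i, f i (x i)) := by
  have : ∀ i, IsFiniteMeasure ((μ i).withDensity fun x => ENNReal.ofReal (f i x)) := fun i =>
    isFiniteMeasure_withDensity_ofReal (hf i).2
  refine (Measure.pi_eq fun s hs => ?_)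
  rw [withDensity_apply _ (.univ_pi hs), Measure.restrict_pi_pi]
  have hint : Integrable (fun x : ∀ i, E i => ∏ i, f i (x i))
      (Measure.pi fun i => (μ i).restrict (s i)) :=
    Integrable.fintype_prod_dep fun i => (hf i).restrict
  rw [← ofReal_integral_eq_lintegral_ofReal hint
      (.of_forall fun x => Finset.prod_nonneg fun i _ => hf0 i _),
    integral_fintype_prod_eq_prod, ENNReal.ofReal_prod_of_nonneg
      fun i _ => integral_nonneg (hf0 i)]
  refine Finset.prod_congr rfl fun i _ => ?_
  rw [withDensity_apply _ (hs i), ← ofReal_integral_eq_lintegral_ofReal (hf i).restrict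
    (.of_forall (hf0 i))]

variable {ι κ : Type*} [Fintype ι] [Fintype κ] {E : Type*} [MeasurableSpace E]

lemma measurePreserving_uncurry (μ : ι → κ → Measure E) [∀ i j, IsProbabilityMeasure (μ i j)] :
    MeasurePreserving (fun (z : ι → κ → E) (p : ι × κ) => z p.1 p.2)
      (Measure.pi fun i => Measure.pi (μ i)) (Measure.pi fun p : ι × κ => μ p.1 p.2) := by
  have hm : Measurable fun (z : ι → κ → E) (p : ι × κ) => z p.1 p.2 := by fun_prop
  refine ⟨hm, (Measure.pi_eq fun s hs => ?_).symm⟩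
  rw [Measure.map_apply hm (.univ_pi hs)]
  have : (fun (z : ι → κ → E) (p : ι × κ) => z p.1 p.2) ⁻¹' Set.univ.pi s
      = Set.univ.pi fun i => Set.univ.pi fun j => s (i, j) := by
    ext z; simp
  rw [this, Measure.pi_pi, Fintype.prod_prod_type]
  exact Finset.prod_congr rfl fun i _ => Measure.pi_pi _ _

lemma measurePreserving_curry (μ : ι → κ → Measure E) [∀ i j, IsProbabilityMeasure (μ i j)] :
    MeasurePreserving (fun (z : ι × κ → E) (i : ι) (j : κ) => z (i, j))
      (Measure.pi fun p : ι × κ => μ p.1 p.2) (Measure.pi fun i => Measure.pi (μ i)) := by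
  have h := measurePreserving_uncurry μ
  have hm : Measurable fun (z : ι × κ → E) (i : ι) (j : κ) => z (i, j) := by fun_prop
  refine ⟨hm, ?_⟩
  rw [← h.map_eq, Measure.map_map hm h.measurable]
  exact Measure.map_id

lemma measurePreserving_swap_pi (μ : ι → κ → Measure E) [∀ i j, IsProbabilityMeasure (μ i j)] :
    MeasurePreserving (fun (z : κ → ι → E) (i : ι) (j : κ) => z j i)
      (Measure.pi fun j => Measure.pi fun i => μ i j) (Measure.pi fun i => Measure.pi (μ i)) := by
  have h1 := measurePreserving_uncurry fun j i => μ i j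
  have h2 := measurePreserving_piCongrLeft (fun p : ι × κ => μ p.1 p.2) (Equiv.prodComm κ ι)
  have h3 := measurePreserving_curry μ
  exact h3.comp (h2.comp h1)

end Product

/-! ### Circularly symmetric complex Gaussian laws -/

section CSCG

lemma measurable_complex_mk : Measurable fun z : ℝ × ℝ => (⟨z.1, z.2⟩ : ℂ) :=
  Complex.measurableEquivRealProd.symm.measurable

instance (v : ℝ≥0) : IsProbabilityMeasure (cscg v) :=
  Measure.isProbabilityMeasure_map measurable_complex_mk.aemeasurable

lemma cscg_eq_withDensity {v : ℝ≥0} (hv : 0 < v) :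
    cscg v = volume.withDensity fun z : ℂ =>
      ENNReal.ofReal ((Real.pi * v)⁻¹ * Real.exp (-(‖z‖ ^ 2 / v))) := by
  have hv2 : v / 2 ≠ 0 := (half_pos hv).ne'
  have hv' : (0 : ℝ) < v := by exact_mod_cast hv
  have hmk : (fun z : ℝ × ℝ => (⟨z.1, z.2⟩ : ℂ)) = Complex.measurableEquivRealProd.symm := rfl
  have hpres := Complex.volume_preserving_equiv_real_prod.symm
  rw [cscg, gaussianReal_of_var_ne_zero _ hv2,
    prod_withDensity (measurable_gaussianPDF _ _) (measurable_gaussianPDF _ _), hmk]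
  ext s hs
  rw [Measure.map_apply (MeasurableEquiv.measurable _) hs,
    withDensity_apply _ (MeasurableEquiv.measurable _ hs), withDensity_apply _ hs,
    ← hpres.setLIntegral_comp_preimage hs (by fun_prop)]
  refine lintegral_congr fun z => ?_
  rw [gaussianPDF, gaussianPDF, ← ENNReal.ofReal_mul (gaussianPDFReal_nonneg _ _ _)]
  congr 1
  have hn : ‖Complex.measurableEquivRealProd.symm z‖ ^ 2 = z.1 ^ 2 + z.2 ^ 2 := by
    rw [← Complex.normSq_eq_norm_sq, Complex.normSq_apply, sq, sq]
    rfl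
  have hsq : √(2 * Real.pi * (v / 2 : ℝ≥0)) * √(2 * Real.pi * (v / 2 : ℝ≥0)) = Real.pi * v := by
    rw [Real.mul_self_sqrt (by positivity)]
    push_cast
    ring
  rw [gaussianPDFReal, gaussianPDFReal, mul_mul_mul_comm, ← mul_inv, hsq, ← Real.exp_add, hn]
  congr 2
  push_cast
  field_simp
  ring

lemma cscg_eq_map_cscg_one (v : ℝ≥0) :
    cscg v = (cscg 1).map fun z => ((√(v : ℝ) : ℝ) : ℂ) * z := by
  have h := gaussianReal_map_const_mul (μ := 0) (v := 1 / 2) √(v : ℝ)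
  have hv : gaussianReal 0 (v / 2) = (gaussianReal 0 (1 / 2)).map (√(v : ℝ) * ·) := by
    rw [h, mul_zero]
    congr 1
    ext
    push_cast
    rw [Real.sq_sqrt v.coe_nonneg]
    ring
  rw [cscg, hv, Measure.map_prod_map _ _ (by fun_prop) (by fun_prop), cscg,
    Measure.map_map measurable_complex_mk (by fun_prop),
    Measure.map_map (by fun_prop) measurable_complex_mk]
  congr 1
  ext z
  exact Complex.ext (by simp) (by simp)

variable {ι κ : Type*} [Fintype ι] [Fintype κ]

/-- The law of a vector with i.i.d. `CN(0, 1)` entries. -/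
def stdCscg (κ : Type*) [Fintype κ] : Measure (κ → ℂ) := Measure.pi fun _ : κ => cscg 1

instance : IsProbabilityMeasure (stdCscg κ) := by unfold stdCscg; infer_instance

variable [DecidableEq ι] [DecidableEq κ]

lemma integrable_cscg_density {s : ℝ} (hs : 0 < s) :
    Integrable fun z : ℂ => (Real.pi * s)⁻¹ * Real.exp (-(‖z‖ ^ 2 / s)) := by
  have h := integrable_gaussDens (ι := Unit) (posDef_smul_one hs)
  have h2 := (volume_preserving_funUnique Unit ℂ).symm.integrable_comp_emb
    (MeasurableEquiv.measurableEmbedding _) (g := gaussDens ((s : ℂ) • (1 : Matrix Unit Unit ℂ)))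
  refine (h2.2 h).congr (.of_forall fun z => ?_)
  rw [Function.comp_apply, gaussDens_smul_one hs, Fintype.prod_unique]
  rfl

lemma pi_cscg_eq_withDensity {v : ℝ≥0} (hv : 0 < v) :
    (Measure.pi fun _ : κ => cscg v) = volume.withDensity fun z : κ → ℂ =>
      ENNReal.ofReal (gaussDens (((v : ℝ) : ℂ) • (1 : Matrix κ κ ℂ)) z) := by
  have hv' : (0 : ℝ) < v := by exact_mod_cast hv
  simp_rw [cscg_eq_withDensity hv]
  rw [pi_withDensity_ofReal _ (fun _ z => by positivity) fun _ => integrable_cscg_density hv']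
  simp_rw [gaussDens_smul_one hv']
  rfl

lemma gaussDens_le {K : Matrix ι ι ℂ} (hK : K.PosDef) (y : ι → ℂ) :
    gaussDens K y ≤ (Real.pi ^ Fintype.card ι * K.det.re)⁻¹ := by
  have := hK.det_re_pos
  have h := quadForm_nonneg hK.inv.posSemidef y
  exact mul_le_of_le_one_right (by positivity) (Real.exp_le_one_iff.2 (by linarith))

lemma integrable_gaussDens_comp {α : Type*} [MeasurableSpace α] {P : Measure α}
    [IsFiniteMeasure P] {K : Matrix ι ι ℂ} (hK : K.PosDef) {f : α → ι → ℂ} (hf : Measurable f) :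
    Integrable (fun a => gaussDens K (f a)) P :=
  .of_bound ((continuous_gaussDens K).measurable.comp hf).aestronglyMeasurable
    (Real.pi ^ Fintype.card ι * K.det.re)⁻¹ (.of_forall fun a => by
      rw [Real.norm_of_nonneg (gaussDens_pos hK _).le]
      exact gaussDens_le hK _)

/-- `M z + √s w` with independent standard vectors `z` and `w` has the law `CN(0, M Mᴴ + s)`; the
density of that law is the average over `z` of the density of `M z + √s w` given `z`. -/
lemma integral_gaussDens_sub_mulVec (M : Matrix ι κ ℂ) {s : ℝ} (hs : 0 < s) (y : ι → ℂ) :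
    ∫ z, gaussDens ((s : ℂ) • 1) (y - M *ᵥ z) ∂stdCscg κ = gaussDens (M * Mᴴ + (s : ℂ) • 1) y := by
  have hs' : (s : ℂ) ≠ 0 := by exact_mod_cast hs.ne'
  set B := M * Mᴴ + (s : ℂ) • (1 : Matrix ι ι ℂ) with hBdef
  have hB : B.PosDef := (Matrix.posSemidef_self_mul_conjTranspose M).add_smul_one_posDef hs
  set J := 1 + (s⁻¹ : ℂ) • (Mᴴ * M) with hJdef
  have hJ : J.PosDef := Matrix.PosDef.one.add_posSemidef
    ((Matrix.posSemidef_conjTranspose_mul_self M).smul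
      (inv_nonneg.2 (by exact_mod_cast hs.le : (0 : ℂ) ≤ s)))
  have hdet : B.det.re = s ^ Fintype.card ι * J.det.re := by
    have : B = (s : ℂ) • (1 + (s⁻¹ : ℂ) • M * Mᴴ) := by
      rw [hBdef, smul_add, Matrix.smul_mul, smul_smul, mul_inv_cancel₀ hs', one_smul, add_comm]
    rw [this, Matrix.det_smul, Matrix.det_one_add_mul_comm, Matrix.mul_smul, ← hJdef,
      ← Complex.ofReal_pow, Complex.re_ofReal_mul]
  have hsq := fun v => (sum_sq_add_sum_sq_sub_mulVec M hs y v).symm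
  rw [← hBdef, ← hJdef] at hsq
  rw [stdCscg, pi_cscg_eq_withDensity one_pos, integral_withDensity_eq_integral_toReal_smul
    (by have := continuous_gaussDens (((1 : ℝ≥0) : ℝ) • (1 : Matrix κ κ ℂ)); fun_prop)
    (.of_forall fun _ => ENNReal.ofReal_lt_top)]
  rw [← integral_add_right_eq_self _ (Mᴴ *ᵥ (B⁻¹ *ᵥ y))]
  have key : ∀ v : κ → ℂ,
      (ENNReal.ofReal (gaussDens ((((1 : ℝ≥0) : ℝ) : ℂ) • (1 : Matrix κ κ ℂ))
        (v + Mᴴ *ᵥ (B⁻¹ *ᵥ y)))).toReal •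
        gaussDens ((s : ℂ) • (1 : Matrix ι ι ℂ)) (y - M *ᵥ (v + Mᴴ *ᵥ (B⁻¹ *ᵥ y)))
      = (Real.pi ^ Fintype.card κ)⁻¹ * ((Real.pi * s) ^ Fintype.card ι)⁻¹
          * Real.exp (-quadForm B⁻¹ y) * Real.exp (-quadForm J v) := by
    intro v
    rw [ENNReal.toReal_ofReal (gaussDens_pos (posDef_smul_one (by simp)) _).le,
      gaussDens_smul_one (by simp), gaussDens_smul_one hs, Finset.prod_mul_distrib,
      Finset.prod_mul_distrib, ← Real.exp_sum, ← Real.exp_sum, mul_assoc _ (Real.exp _),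
      ← Real.exp_add, ← neg_add, hsq v, smul_eq_mul,
      mul_mul_mul_comm, ← Real.exp_add]
    simp only [Finset.prod_const, Finset.card_univ, NNReal.coe_one, mul_one, inv_pow,
      Finset.sum_neg_distrib, div_one, ← Finset.sum_div, neg_add]
  simp_rw [key]
  rw [integral_const_mul, integral_exp_neg_quadForm hJ, gaussDens, hdet]
  have := hJ.det_re_pos
  rw [mul_pow]
  field_simp

end CSCG

end UplinkISAC

namespace UplinkISAC

/-! ### Relative entropy -/

section KL

variable {α β γ δ Ω : Type*} [MeasurableSpace α] [MeasurableSpace β] [MeasurableSpace γ]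
  [MeasurableSpace δ] [MeasurableSpace Ω]

/-- Replacing the second marginal by another law can only increase the divergence from the product:
the difference is the divergence between the second marginal and that law. -/
lemma klDiv_fst_prod_snd_le [StandardBorelSpace α] [Nonempty α] (ρ : Measure (α × β))
    [IsProbabilityMeasure ρ] (Q : Measure β) [IsProbabilityMeasure Q] :
    klDiv ρ (ρ.fst.prod ρ.snd) ≤ klDiv ρ (ρ.fst.prod Q) := by
  set ρ' : Measure (β × α) := ρ.map Prod.swap with hρ'
  have : IsProbabilityMeasure ρ' := Measure.isProbabilityMeasure_map measurable_swap.aemeasurable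
  have hfst : ρ'.fst = ρ.snd := Measure.fst_map_swap
  have hback : ρ'.map Prod.swap = ρ := by
    rw [hρ', Measure.map_map measurable_swap measurable_swap, Prod.swap_swap_eq, Measure.map_id]
  have hchain := klDiv_compProd_eq_add ρ.snd Q ρ'.condKernel (Kernel.const β ρ.fst)
  rw [← hfst, ρ'.disintegrate, Measure.compProd_const, Measure.compProd_const, hfst] at hchain
  calc klDiv ρ (ρ.fst.prod ρ.snd)
      = klDiv (ρ'.map Prod.swap) ((ρ.snd.prod ρ.fst).map Prod.swap) := by
        rw [hback, Measure.prod_swap]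
    _ ≤ klDiv ρ' (ρ.snd.prod ρ.fst) := klDiv_map_le _ _ measurable_swap
    _ ≤ klDiv ρ' (Q.prod ρ.fst) := by rw [hchain]; exact le_add_self
    _ = klDiv (ρ.map Prod.swap) ((ρ.fst.prod Q).map Prod.swap) := by rw [Measure.prod_swap]
    _ ≤ klDiv ρ (ρ.fst.prod Q) := klDiv_map_le _ _ measurable_swap

/-- The Donsker-Varadhan bound, for a normalized exponential weight: the difference of the two
sides is the divergence of `ρ` from the tilted measure `exp f • ν`. -/
lemma ofReal_integral_le_klDiv (ρ ν : Measure α) [IsProbabilityMeasure ρ] [IsProbabilityMeasure ν]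
    {f : α → ℝ} (hf : Integrable f ρ) (hexp : ∫ x, Real.exp (f x) ∂ν = 1) :
    ENNReal.ofReal (∫ x, f x ∂ρ) ≤ klDiv ρ ν := by
  by_cases hac : ρ ≪ ν
  swap; · simp [klDiv_of_not_ac hac]
  by_cases hint : Integrable (llr ρ ν) ρ
  swap; · simp [klDiv_of_not_integrable hint]
  have hexp' : Integrable (fun x => Real.exp (f x)) ν :=
    .of_integral_ne_zero (by rw [hexp]; exact one_ne_zero)
  have : IsProbabilityMeasure (ν.tilted f) := isProbabilityMeasure_tilted hexp'
  have h1 := integral_llr_tilted_right hac hf hexp' hint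
  have h2 := integral_llr_add_sub_measure_univ_nonneg
    (hac.trans (absolutelyContinuous_tilted hexp'))
    (integrable_llr_tilted_right hac hf hint hexp')
  rw [klDiv_of_ac_of_integrable hac hint]
  refine ENNReal.ofReal_le_ofReal ?_
  rw [hexp, Real.log_one] at h1
  simp only [probReal_univ] at h2 ⊢
  linarith

/-- The divergence of two laws with positive densities with respect to the same measure. -/
lemma klDiv_withDensity_ofReal (ν : Measure α) [SigmaFinite ν] {p q : α → ℝ} (hp : Measurable p)
    (hq : Measurable q) (hp0 : ∀ x, 0 < p x) (hq0 : ∀ x, 0 < q x)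
    [hP : IsProbabilityMeasure (ν.withDensity fun x => ENNReal.ofReal (p x))]
    [hQ : IsProbabilityMeasure (ν.withDensity fun x => ENNReal.ofReal (q x))]
    (hint : Integrable (fun x => Real.log (p x) - Real.log (q x))
      (ν.withDensity fun x => ENNReal.ofReal (p x))) :
    klDiv (ν.withDensity fun x => ENNReal.ofReal (p x))
        (ν.withDensity fun x => ENNReal.ofReal (q x))
      = ENNReal.ofReal (∫ x, (Real.log (p x) - Real.log (q x))
          ∂(ν.withDensity fun x => ENNReal.ofReal (p x))) ∧
    0 ≤ ∫ x, (Real.log (p x) - Real.log (q x)) ∂(ν.withDensity fun x => ENNReal.ofReal (p x)) := by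
  set P := ν.withDensity fun x => ENNReal.ofReal (p x) with hPdef
  set Q := ν.withDensity fun x => ENNReal.ofReal (q x) with hQdef
  have hPQ : P = Q.withDensity fun x => ENNReal.ofReal (p x / q x) := by
    rw [hQdef, ← withDensity_mul _ (by fun_prop) (by fun_prop), hPdef]
    congr 1
    ext x
    rw [Pi.mul_apply, ← ENNReal.ofReal_mul (hq0 x).le, mul_div_cancel₀ _ (hq0 x).ne']
  have hac : P ≪ Q := hPQ ▸ withDensity_absolutelyContinuous _ _
  have hrn : P.rnDeriv Q =ᵐ[P] fun x => ENNReal.ofReal (p x / q x) := by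
    have h := Measure.rnDeriv_withDensity Q (f := fun x => ENNReal.ofReal (p x / q x))
      (by fun_prop)
    rw [← hPQ] at h
    exact hac.ae_le h
  have hllr : llr P Q =ᵐ[P] fun x => Real.log (p x) - Real.log (q x) := by
    filter_upwards [hrn] with x hx
    rw [llr, hx, ENNReal.toReal_ofReal (div_pos (hp0 x) (hq0 x)).le,
      Real.log_div (hp0 x).ne' (hq0 x).ne']
  have hllr_int : Integrable (llr P Q) P := hint.congr hllr.symm
  have h0 := integral_llr_add_sub_measure_univ_nonneg hac hllr_int
  have h1 := klDiv_of_ac_of_integrable hac hllr_int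
  simp only [probReal_univ, add_sub_cancel_right, integral_congr_ae hllr] at h0 h1
  exact ⟨h1, h0⟩

/-- If `V` is independent of `Z`, then conditioning `F (Z, V)` on `Z = z` amounts to fixing the
first argument of `F`. -/
lemma condDistrib_comp_prod_of_indepFun [StandardBorelSpace β] [Nonempty β] {μ : Measure Ω}
    [IsProbabilityMeasure μ] {Z : Ω → γ} {V : Ω → δ} (hZ : AEMeasurable Z μ)
    (hV : AEMeasurable V μ) (hind : IndepFun Z V μ) {F : γ × δ → β} (hF : Measurable F) :
    condDistrib (fun ω => F (Z ω, V ω)) Z μ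
      =ᵐ[μ.map Z] fun z => (μ.map V).map fun v => F (z, v) := by
  have : IsProbabilityMeasure (μ.map V) := Measure.isProbabilityMeasure_map hV
  have : IsProbabilityMeasure (μ.map Z) := Measure.isProbabilityMeasure_map hZ
  let κ : Kernel γ β := (Kernel.id ×ₖ Kernel.const γ (μ.map V)).map F
  have hκ : ∀ z, κ z = (μ.map V).map fun v => F (z, v) := by
    intro z
    rw [Kernel.map_apply _ hF, Kernel.prod_apply, Kernel.id_apply, Kernel.const_apply,
      Measure.dirac_prod, Measure.map_map hF (by fun_prop)]
    rfl
  have : IsMarkovKernel κ := Kernel.IsMarkovKernel.map _ hF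
  have h := condDistrib_ae_eq_of_measure_eq_compProd (μ := μ) Z
    (Y := fun ω => F (Z ω, V ω)) (hF.comp_aemeasurable (hZ.prodMk hV)) (κ := κ) ?_
  · exact h.trans (.of_forall hκ)
  · have hjoint : μ.map (fun ω => (Z ω, V ω)) = (μ.map Z).prod (μ.map V) :=
      (indepFun_iff_map_prod_eq_prod_map_map hZ hV).1 hind
    have hm : Measurable fun x : γ × δ => (x.1, F x) := by fun_prop
    have : (fun ω => (Z ω, F (Z ω, V ω))) = (fun x : γ × δ => (x.1, F x)) ∘ fun ω => (Z ω, V ω) :=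
      rfl
    rw [this, ← AEMeasurable.map_map_of_aemeasurable hm.aemeasurable (hZ.prodMk hV), hjoint]
    ext s hs
    rw [Measure.map_apply hm hs, Measure.prod_apply (hm hs), Measure.compProd_apply hs]
    refine lintegral_congr fun z => ?_
    rw [hκ, Measure.map_apply (by fun_prop) (measurable_prodMk_left hs)]
    rfl

/-- Conditional mutual information for signals that are functions of `Z` and of a variable
independent of `Z`. -/
lemma condMutualInfo_of_indepFun [StandardBorelSpace α] [Nonempty α] [StandardBorelSpace β]
    [Nonempty β] {μ : Measure Ω} [IsProbabilityMeasure μ] {Z : Ω → γ} {V : Ω → δ}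
    (hZ : AEMeasurable Z μ) (hV : AEMeasurable V μ) (hind : IndepFun Z V μ) {F : γ × δ → α}
    {F' : γ × δ → β} (hF : Measurable F) (hF' : Measurable F') :
    condMutualInfo μ (fun ω => F (Z ω, V ω)) (fun ω => F' (Z ω, V ω)) Z
      = ∫⁻ z, klDiv ((μ.map V).map fun v => (F (z, v), F' (z, v)))
          (((μ.map V).map fun v => F (z, v)).prod ((μ.map V).map fun v => F' (z, v)))
          ∂(μ.map Z) := by
  refine lintegral_congr_ae ?_
  filter_upwards [condDistrib_comp_prod_of_indepFun hZ hV hind hF,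
    condDistrib_comp_prod_of_indepFun hZ hV hind hF',
    condDistrib_comp_prod_of_indepFun hZ hV hind (hF.prodMk hF')] with z h1 h2 h3
  rw [h1, h2, h3]

end KL

end UplinkISAC

namespace UplinkISAC

/-! ### Determinants and traces of positive definite matrices -/

section PosDef

variable {ι : Type*} [Fintype ι] [DecidableEq ι]

lemma pow_card_le_det_re {A : Matrix ι ι ℂ} (hA : A.PosSemidef) {s : ℝ} (hs : 0 < s) :
    s ^ Fintype.card ι ≤ (A + (s : ℂ) • (1 : Matrix ι ι ℂ)).det.re := by
  have h := integral_gaussDens_sub_mulVec (CFC.sqrt A) hs (0 : ι → ℂ)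
  have hsA : (CFC.sqrt A).PosSemidef := Matrix.nonneg_iff_posSemidef.1 (CFC.sqrt_nonneg A)
  have hB := hA.add_smul_one_posDef hs
  rw [hsA.isHermitian.eq, CFC.sqrt_mul_sqrt_self A hA.nonneg] at h
  -- The density of `CN(0, A + s)` at `0` is an average of values of the density of `CN(0, s)`.
  have h1 : gaussDens (A + (s : ℂ) • 1) 0 ≤ gaussDens ((s : ℂ) • (1 : Matrix ι ι ℂ)) 0 := by
    rw [← h]
    refine (integral_mono (integrable_gaussDens_comp (posDef_smul_one hs)
      (by unfold Matrix.mulVec dotProduct; fun_prop)) (integrable_const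
        (gaussDens ((s : ℂ) • (1 : Matrix ι ι ℂ)) 0)) fun z => ?_).trans (by simp)
    refine (gaussDens_le (posDef_smul_one hs) _).trans (by simp [gaussDens, quadForm])
  have hd : ((s : ℂ) • (1 : Matrix ι ι ℂ)).det.re = s ^ Fintype.card ι := by
    rw [Matrix.det_smul, Matrix.det_one, mul_one, ← Complex.ofReal_pow, Complex.ofReal_re]
  have hpos := hB.det_re_pos
  simp only [gaussDens, quadForm, star_zero, zero_dotProduct, Complex.zero_re, neg_zero,
    Real.exp_zero, mul_one, hd] at h1
  rw [inv_le_inv₀ (by positivity) (by positivity)] at h1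
  exact le_of_mul_le_mul_left h1 (by positivity)

lemma log_det_re_le_trace {K : Matrix ι ι ℂ} (hK : K.PosDef) :
    Real.log K.det.re ≤ K.trace.re - Fintype.card ι := by
  have hpos : ∀ i, 0 < hK.isHermitian.eigenvalues i := fun i => hK.eigenvalues_pos i
  have hdet : K.det.re = ∏ i, hK.isHermitian.eigenvalues i := by
    rw [hK.isHermitian.det_eq_prod_eigenvalues]
    norm_cast
  have htr : K.trace.re = ∑ i, hK.isHermitian.eigenvalues i := by
    rw [hK.isHermitian.trace_eq_sum_eigenvalues]
    norm_cast
  rw [hdet, htr, Real.log_prod fun i _ => (hpos i).ne']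
  calc ∑ i, Real.log (hK.isHermitian.eigenvalues i)
      ≤ ∑ i, (hK.isHermitian.eigenvalues i - 1) :=
        Finset.sum_le_sum fun i _ => Real.log_le_sub_one_of_pos (hpos i)
    _ = _ := by simp

lemma trace_inv_add_smul_one {A : Matrix ι ι ℂ} (hA : A.PosSemidef) {s : ℝ} (hs : 0 < s) :
    ((A + (s : ℂ) • (1 : Matrix ι ι ℂ))⁻¹ * A).trace.re
      = Fintype.card ι - s * (A + (s : ℂ) • (1 : Matrix ι ι ℂ))⁻¹.trace.re := by
  have hB := hA.add_smul_one_posDef hs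
  set B := A + (s : ℂ) • (1 : Matrix ι ι ℂ) with hBdef
  have hA' : A = B - (s : ℂ) • (1 : Matrix ι ι ℂ) := by rw [hBdef]; abel
  rw [hA', Matrix.mul_sub, Matrix.nonsing_inv_mul _ ((Matrix.isUnit_iff_isUnit_det _).1 hB.isUnit),
    Matrix.mul_smul, Matrix.mul_one, Matrix.trace_sub, Matrix.trace_one, Matrix.trace_smul,
    smul_eq_mul, Complex.sub_re, Complex.re_ofReal_mul, Complex.natCast_re]

lemma trace_inv_add_smul_one_le {A : Matrix ι ι ℂ} (hA : A.PosSemidef) {s : ℝ} (hs : 0 < s) :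
    s * (A + (s : ℂ) • (1 : Matrix ι ι ℂ))⁻¹.trace.re ≤ Fintype.card ι := by
  have h := trace_inv_add_smul_one hA hs
  have hB := (hA.add_smul_one_posDef hs).inv.posSemidef
  have hsA : (CFC.sqrt A).PosSemidef := Matrix.nonneg_iff_posSemidef.1 (CFC.sqrt_nonneg A)
  have h0 : 0 ≤ ((A + (s : ℂ) • (1 : Matrix ι ι ℂ))⁻¹ * A).trace.re := by
    have h1 := (hB.mul_mul_conjTranspose_same (CFC.sqrt A)).trace_nonneg
    rw [hsA.isHermitian.eq, Matrix.trace_mul_comm, ← Matrix.mul_assoc,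
      CFC.sqrt_mul_sqrt_self A hA.nonneg, Matrix.trace_mul_comm] at h1
    exact (Complex.nonneg_iff.1 h1).1
  linarith

lemma trace_inv_re_nonneg {K : Matrix ι ι ℂ} (hK : K.PosDef) : 0 ≤ K⁻¹.trace.re :=
  (Complex.nonneg_iff.1 hK.inv.posSemidef.trace_nonneg).1

end PosDef

/-! ### Second moments -/

section Moments

variable {α β : Type*} [MeasurableSpace α] [MeasurableSpace β] {P : Measure α}
  {ι κ : Type*}

/-- The random vector `v` has square-integrable entries, and `E[v vᴴ] = C`. -/
structure HasMoment (P : Measure α) (v : ι → α → ℂ) (C : Matrix ι ι ℂ) : Prop where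
  memLp : ∀ i, MemLp (v i) 2 P
  integral_mul_star : ∀ i j, ∫ x, v i x * star (v j x) ∂P = C i j

/-- The random vector `v` is centred, with square-integrable entries and covariance matrix `C`. -/
structure HasCov (P : Measure α) (v : ι → α → ℂ) (C : Matrix ι ι ℂ) : Prop
    extends HasMoment P v C where
  integral_eq_zero : ∀ i, ∫ x, v i x ∂P = 0

lemma _root_.MeasureTheory.MemLp.integrable_mul_star {f g : α → ℂ} (hf : MemLp f 2 P)
    (hg : MemLp g 2 P) : Integrable (fun x => f x * star (g x)) P :=
  MemLp.integrable_mul hf hg.star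

lemma integral_add_add_add {f₁ f₂ f₃ f₄ : α → ℂ} (h₁ : Integrable f₁ P) (h₂ : Integrable f₂ P)
    (h₃ : Integrable f₃ P) (h₄ : Integrable f₄ P) :
    ∫ x, (f₁ x + f₂ x + f₃ x + f₄ x) ∂P
      = ∫ x, f₁ x ∂P + ∫ x, f₂ x ∂P + ∫ x, f₃ x ∂P + ∫ x, f₄ x ∂P := by
  rw [integral_add (f := fun x => f₁ x + f₂ x + f₃ x) ((h₁.add h₂).add h₃) h₄,
    integral_add (f := fun x => f₁ x + f₂ x) (h₁.add h₂) h₃, integral_add h₁ h₂]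

lemma HasMoment.integrable {v : ι → α → ℂ} {C : Matrix ι ι ℂ} (h : HasMoment P v C) (i j : ι) :
    Integrable (fun x => v i x * star (v j x)) P := (h.memLp i).integrable_mul_star (h.memLp j)

lemma HasMoment.reindex {v : ι → α → ℂ} {C : Matrix ι ι ℂ} (h : HasMoment P v C) (e : κ → ι) :
    HasMoment P (fun k => v (e k)) (C.submatrix e e) :=
  ⟨fun k => h.memLp (e k), fun k l => h.integral_mul_star (e k) (e l)⟩

lemma HasCov.reindex {v : ι → α → ℂ} {C : Matrix ι ι ℂ} (h : HasCov P v C) (e : κ → ι) :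
    HasCov P (fun k => v (e k)) (C.submatrix e e) :=
  ⟨h.toHasMoment.reindex e, fun k => h.integral_eq_zero (e k)⟩

lemma HasCov.map {f : α → β} (hf : AEMeasurable f P) {v : ι → β → ℂ} (hv : ∀ i, Measurable (v i))
    {C : Matrix ι ι ℂ} (h : HasCov P (fun i x => v i (f x)) C) : HasCov (P.map f) v C where
  memLp i := (memLp_map_measure_iff (hv i).aestronglyMeasurable hf).2 (h.memLp i)
  integral_mul_star i j := by
    have hm : Measurable fun x => v i x * star (v j x) :=
      (hv i).mul (continuous_star.measurable.comp (hv j))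
    rw [integral_map hf hm.aestronglyMeasurable]
    exact h.integral_mul_star i j
  integral_eq_zero i := by
    rw [integral_map hf (hv i).aestronglyMeasurable]
    exact h.integral_eq_zero i

lemma HasMoment.linear [Fintype ι] {v : ι → α → ℂ} {C : Matrix ι ι ℂ} (h : HasMoment P v C)
    (N : Matrix κ ι ℂ) : HasMoment P (fun k x => (N *ᵥ fun i => v i x) k) (N * C * Nᴴ) where
  memLp k := memLp_finsetSum _ fun i _ => (h.memLp i).const_mul (N k i)
  integral_mul_star k l := by
    have : ∀ x, (N *ᵥ fun i => v i x) k * star ((N *ᵥ fun i => v i x) l)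
        = ∑ j, ∑ i, (N k i * star (N l j)) * (v i x * star (v j x)) := by
      intro x
      simp only [Matrix.mulVec, dotProduct, star_sum, star_mul', Finset.sum_mul_sum]
      rw [Finset.sum_comm]
      exact Finset.sum_congr rfl fun i _ => Finset.sum_congr rfl fun j _ => by ring
    simp_rw [this]
    rw [integral_finsetSum _ fun j _ => integrable_finsetSum _ fun i _ =>
      (h.integrable i j).const_mul _]
    simp_rw [integral_finsetSum _ fun i _ => (h.integrable i _).const_mul (N k i * star (N l _)),
      integral_const_mul, h.integral_mul_star, Matrix.mul_apply, Matrix.conjTranspose_apply,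
      Finset.sum_mul]
    exact Finset.sum_congr rfl fun i _ => Finset.sum_congr rfl fun j _ => by ring

lemma HasCov.linear [Fintype ι] [IsFiniteMeasure P] {v : ι → α → ℂ} {C : Matrix ι ι ℂ}
    (h : HasCov P v C) (N : Matrix κ ι ℂ) :
    HasCov P (fun k x => (N *ᵥ fun i => v i x) k) (N * C * Nᴴ) where
  toHasMoment := h.toHasMoment.linear N
  integral_eq_zero k := by
    simp only [Matrix.mulVec, dotProduct]
    rw [integral_finsetSum _ fun i _ => ((h.memLp i).integrable one_le_two).const_mul _]
    simp [integral_const_mul, h.integral_eq_zero]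

lemma HasMoment.posSemidef [Fintype ι] {v : ι → α → ℂ} {C : Matrix ι ι ℂ}
    (h : HasMoment P v C) : C.PosSemidef := by
  refine Matrix.PosSemidef.of_dotProduct_mulVec_nonneg ?_ fun y => ?_
  · ext i j
    rw [Matrix.conjTranspose_apply, ← h.integral_mul_star, ← h.integral_mul_star]
    rw [RCLike.star_def, ← integral_conj]
    simp [mul_comm]
  · have h1 := (h.linear (Matrix.of fun (_ : Unit) i => star (y i))).integral_mul_star () ()
    have h2 : ((Matrix.of fun (_ : Unit) i => star (y i)) * C *
        (Matrix.of fun (_ : Unit) i => star (y i))ᴴ) () () = star y ⬝ᵥ (C *ᵥ y) := by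
      rw [Matrix.mul_assoc]
      simp [Matrix.mul_apply, Matrix.mulVec, dotProduct]
    rw [← h2, ← h1]
    simp_rw [RCLike.star_def, Complex.mul_conj]
    rw [integral_complex_ofReal]
    exact_mod_cast integral_nonneg fun x => Complex.normSq_nonneg _

/-- The real part of `E[vᴴ N v] = tr(N C)`. -/
lemma HasMoment.integral_quadForm [Fintype ι] {v : ι → α → ℂ} {C : Matrix ι ι ℂ}
    (h : HasMoment P v C) (N : Matrix ι ι ℂ) :
    Integrable (fun x => quadForm N fun i => v i x) P ∧
      ∫ x, quadForm N (fun i => v i x) ∂P = (N * C).trace.re := by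
  have h1 : ∀ x, (star fun i => v i x) ⬝ᵥ (N *ᵥ fun i => v i x)
      = ∑ i, ∑ j, N i j * (v j x * star (v i x)) := by
    intro x
    simp only [Matrix.mulVec, dotProduct, Pi.star_apply, Finset.mul_sum]
    exact Finset.sum_congr rfl fun i _ => Finset.sum_congr rfl fun j _ => by ring
  have hi : ∀ i j, Integrable (fun x => N i j * (v j x * star (v i x))) P := fun i j =>
    (h.integrable j i).const_mul _
  have hi' : Integrable (fun x => ∑ i, ∑ j, N i j * (v j x * star (v i x))) P :=
    integrable_finsetSum _ fun i _ => integrable_finsetSum _ fun j _ => hi i j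
  simp only [quadForm, h1]
  refine ⟨hi'.re, ?_⟩
  have := integral_re hi'
  simp only [RCLike.re_eq_complex_re] at this
  rw [this, integral_finsetSum _ fun i _ => integrable_finsetSum _ fun j _ => hi i j]
  simp_rw [integral_finsetSum _ fun j _ => hi _ j, integral_const_mul, h.integral_mul_star]
  simp [Matrix.trace, Matrix.mul_apply]

lemma HasCov.const_add [IsProbabilityMeasure P] {v : ι → α → ℂ} {C : Matrix ι ι ℂ}
    (h : HasCov P v C) (c : ι → ℂ) :
    HasMoment P (fun i x => c i + v i x) (Matrix.vecMulVec c (star c) + C) where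
  memLp i := (memLp_const (c i)).add (h.memLp i)
  integral_mul_star i j := by
    have h1 : ∀ x, (c i + v i x) * star (c j + v j x)
        = c i * star (c j) + c i * star (v j x) + v i x * star (c j) + v i x * star (v j x) :=
      fun x => by rw [star_add]; ring
    have hi := fun i => (h.memLp i).integrable one_le_two
    have hs : Integrable (fun x => c i * star (v j x)) P :=
      (((h.memLp j).star).integrable one_le_two).const_mul _
    have hz : ∫ x, star (v j x) ∂P = 0 := by
      simp_rw [RCLike.star_def]
      rw [integral_conj, h.integral_eq_zero, map_zero]
    simp_rw [h1]
    rw [integral_add_add_add (integrable_const _) hs ((hi i).mul_const _) (h.integrable i j),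
      integral_const_mul (c i) fun x => star (v j x), hz,
      integral_mul_const (star (c j)) (v i), h.integral_eq_zero, h.integral_mul_star]
    simp [Matrix.vecMulVec_apply]

lemma HasCov.add_prod {Q : Measure β} [IsProbabilityMeasure P] [IsProbabilityMeasure Q]
    {v : ι → α → ℂ} {w : ι → β → ℂ} {C D : Matrix ι ι ℂ} (hv : HasCov P v C) (hw : HasCov Q w D) :
    HasCov (P.prod Q) (fun i x => v i x.1 + w i x.2) (C + D) where
  memLp i := ((hv.memLp i).comp_fst Q).add ((hw.memLp i).comp_snd P)
  integral_eq_zero i := by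
    rw [integral_add (((hv.memLp i).integrable one_le_two).comp_fst Q)
      (((hw.memLp i).integrable one_le_two).comp_snd P), integral_fun_fst, integral_fun_snd,
      hv.integral_eq_zero, hw.integral_eq_zero]
    simp
  integral_mul_star i j := by
    have h1 : ∀ x : α × β, (v i x.1 + w i x.2) * star (v j x.1 + w j x.2)
        = v i x.1 * star (v j x.1) + v i x.1 * star (w j x.2) + star (v j x.1) * w i x.2
          + w i x.2 * star (w j x.2) := fun x => by rw [star_add]; ring
    have hvi := fun i => (hv.memLp i).integrable one_le_two
    have hwi := fun i => (hw.memLp i).integrable one_le_two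
    have hvs := fun i => (hv.memLp i).star.integrable one_le_two
    have hws := fun i => (hw.memLp i).star.integrable one_le_two
    have e1 : Integrable (fun x : α × β => v i x.1 * star (v j x.1)) (P.prod Q) :=
      (hv.integrable i j).comp_fst Q
    have e2 : Integrable (fun x : α × β => v i x.1 * star (w j x.2)) (P.prod Q) :=
      (hvi i).mul_prod (hws j)
    have e3 : Integrable (fun x : α × β => star (v j x.1) * w i x.2) (P.prod Q) :=
      (hvs j).mul_prod (hwi i)
    have e4 : Integrable (fun x : α × β => w i x.2 * star (w j x.2)) (P.prod Q) :=
      (hw.integrable i j).comp_snd P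
    simp_rw [h1]
    rw [integral_add_add_add e1 e2 e3 e4,
      integral_prod_mul (v i) fun y => star (w j y),
      integral_prod_mul (fun x => star (v j x)) (w i), hv.integral_eq_zero, hw.integral_eq_zero,
      integral_fun_fst fun x => v i x * star (v j x),
      integral_fun_snd fun x => w i x * star (w j x), hv.integral_mul_star, hw.integral_mul_star]
    simp

/-- Stacking independent centred vectors gives a block diagonal covariance matrix. -/
lemma HasCov.pi [Fintype κ] [DecidableEq κ] {Q : κ → Measure α} [∀ k, IsProbabilityMeasure (Q k)]
    {v : ι → α → ℂ} {C : κ → Matrix ι ι ℂ} (h : ∀ k, HasCov (Q k) v (C k)) :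
    HasCov (Measure.pi Q) (fun (a : κ × ι) x => v a.2 (x a.1))
      (Matrix.of fun a b => if a.1 = b.1 then C a.1 a.2 b.2 else 0) where
  memLp a := ((h a.1).memLp a.2).comp_measurePreserving (measurePreserving_eval Q a.1)
  integral_eq_zero a := by
    rw [integral_comp_eval (μ := Q) (i := a.1) ((h a.1).memLp a.2).1]
    exact (h a.1).integral_eq_zero a.2
  integral_mul_star a b := by
    obtain ⟨k, i⟩ := a
    obtain ⟨l, j⟩ := b
    simp only [Matrix.of_apply]
    split_ifs with hkl
    · subst hkl
      rw [integral_comp_eval (μ := Q) (i := k) (f := fun x => v i x * star (v j x))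
        (((h k).memLp i).1.mul ((h k).memLp j).1.star)]
      exact (h k).integral_mul_star i j
    · have hind := (iIndepFun_pi (μ := Q) (X := fun _ x => x) fun _ => aemeasurable_id).indepFun hkl
      have e1 := measurePreserving_eval Q k
      have e2 := measurePreserving_eval Q l
      have hm1 : AEStronglyMeasurable (fun x => v i x) ((Measure.pi Q).map fun x => x k) := by
        rw [show (Measure.pi Q).map (fun x => x k) = Q k from e1.map_eq]
        exact ((h k).memLp i).1
      have hm2 : AEStronglyMeasurable (fun x => star (v j x))
          ((Measure.pi Q).map fun x => x l) := by
        rw [show (Measure.pi Q).map (fun x => x l) = Q l from e2.map_eq]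
        exact ((h l).memLp j).1.star
      rw [hind.integral_fun_comp_mul_comp (measurable_pi_apply k).aemeasurable
        (measurable_pi_apply l).aemeasurable hm1 hm2,
        integral_comp_eval (μ := Q) (i := k) ((h k).memLp i).1, (h k).integral_eq_zero, zero_mul]

lemma HasCov.pi_smul_one [Fintype κ] [DecidableEq κ] [DecidableEq ι] {Q : Measure α}
    [IsProbabilityMeasure Q] {v : ι → α → ℂ} {s : ℂ} (h : HasCov Q v (s • 1)) :
    HasCov (Measure.pi fun _ : κ => Q) (fun (a : κ × ι) x => v a.2 (x a.1)) (s • 1) := by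
  convert! HasCov.pi (κ := κ) (fun _ => h) using 1
  ext a b
  simp only [Matrix.smul_apply, Matrix.one_apply, Matrix.of_apply, Prod.ext_iff]
  split_ifs <;> simp_all

lemma hasCov_ofReal_gaussianReal (v : ℝ≥0) :
    HasCov (gaussianReal 0 v) (fun (_ : Unit) x => (x : ℂ)) (((v : ℝ) : ℂ) • 1) where
  memLp _ := (memLp_id_gaussianReal 2).ofReal
  integral_eq_zero _ := by
    rw [integral_complex_ofReal, integral_id_gaussianReal, Complex.ofReal_zero]
  integral_mul_star _ _ := by
    have h := variance_fun_id_gaussianReal (μ := 0) (v := v)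
    rw [variance_of_integral_eq_zero (by fun_prop) (by simp [integral_id_gaussianReal])] at h
    simp_rw [RCLike.star_def, Complex.conj_ofReal, ← Complex.ofReal_mul, ← sq]
    rw [integral_complex_ofReal, h]
    simp

lemma hasCov_cscg (v : ℝ≥0) :
    HasCov (cscg v) (fun (_ : Unit) z => z) (((v : ℝ) : ℂ) • 1) := by
  refine HasCov.map measurable_complex_mk.aemeasurable (fun _ => measurable_id) ?_
  have h := hasCov_ofReal_gaussianReal (v / 2)
  have h2 := h.add_prod (h.linear (Complex.I • 1))
  convert! h2 using 1
  · ext _ z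
    exact Complex.ext (by simp [Matrix.smul_mulVec]) (by simp [Matrix.smul_mulVec])
  · ext
    simp [Matrix.conjTranspose_smul]
    linear_combination ((v : ℂ) / 2) * Complex.I_mul_I

end Moments

end UplinkISAC

namespace UplinkISAC

/-! ### The output law for a fixed communication channel -/

section FixedChannel

variable {Nc Nx Nt Nr : ℕ} {κ : Type*} [Fintype κ]

/-- A family of `Nc` matrices of size `m × n`, one per subcarrier. -/
abbrev Blocks (Nc m n : ℕ) : Type := Fin Nc → Fin m → Fin n → ℂ

instance {m n : ℕ} : SigmaFinite (volume : Measure (Blocks Nc m n)) := by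
  have : SigmaFinite (volume : Measure (Fin m → Fin n → ℂ)) := inferInstance
  infer_instance

instance {m n : ℕ} : (volume : Measure (Blocks Nc m n)).IsAddRightInvariant := by
  have : SigmaFinite (volume : Measure (Fin m → Fin n → ℂ)) := inferInstance
  have : (volume : Measure (Fin m → Fin n → ℂ)).IsAddLeftInvariant := inferInstance
  have : (volume : Measure (Blocks Nc m n)).IsAddLeftInvariant := inferInstance
  infer_instance

/-- The useful part `X H` of the received signal. -/
def usefulSignal (x : Blocks Nc Nx Nt) (H : Blocks Nc Nt Nr) : Blocks Nc Nx Nr :=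
  fun p n r => ∑ t, x p n t * H p t r

/-- The received signal `X H + X G + W`, where the column with the index `r` of the stacked matrix
`G` is `T z_r`. -/
def channelOutput (T : Matrix (Fin Nc × Fin Nt) κ ℂ) (H : Blocks Nc Nt Nr) (x : Blocks Nc Nx Nt)
    (z : Fin Nr → κ → ℂ) (w : Blocks Nc Nx Nr) : Blocks Nc Nx Nr :=
  fun p n r => usefulSignal x H p n r + (((blkDiag x * T) *ᵥ z r) (p, n) + w p n r)

/-- The conditional covariance matrix `X S Xᴴ + s` of each column of the stacked received
signal, given `X = x`. -/
def columnCov (S : Matrix (Fin Nc × Fin Nt) (Fin Nc × Fin Nt) ℂ) (s : ℝ) (x : Blocks Nc Nx Nt) :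
    Matrix (Fin Nc × Fin Nx) (Fin Nc × Fin Nx) ℂ :=
  blkDiag x * S * (blkDiag x)ᴴ + (s : ℂ) • 1

/-- The joint law of the `Nr` independent standard vectors that generate the columns of `G`. -/
def interferenceLaw (Nr : ℕ) (κ : Type*) [Fintype κ] : Measure (Fin Nr → κ → ℂ) :=
  Measure.pi fun _ => stdCscg κ

/-- The law of the noise. -/
def noiseLaw (Nc Nx Nr : ℕ) (σ2 : ℝ≥0) : Measure (Blocks Nc Nx Nr) :=
  Measure.pi fun _ => Measure.pi fun _ => Measure.pi fun _ => cscg σ2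

instance : IsProbabilityMeasure (interferenceLaw Nr κ) := by
  unfold interferenceLaw; infer_instance

instance (σ2 : ℝ≥0) : IsProbabilityMeasure (noiseLaw Nc Nx Nr σ2) := by
  unfold noiseLaw; infer_instance

lemma blkDiag_apply {m n : ℕ} (M : Blocks Nc m n) (a : Fin Nc × Fin m) (b : Fin Nc × Fin n) :
    blkDiag M a b = if a.1 = b.1 then M a.1 a.2 b.2 else 0 := by
  simp [blkDiag, Matrix.blockDiagonal_apply]

lemma continuous_blkDiag {m n : ℕ} :
    Continuous (blkDiag : Blocks Nc m n → Matrix (Fin Nc × Fin m) (Fin Nc × Fin n) ℂ) := by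
  refine continuous_matrix fun a b => ?_
  have h : (fun M : Blocks Nc m n => blkDiag M a b)
      = fun M => if a.1 = b.1 then M a.1 a.2 b.2 else 0 := funext fun M => blkDiag_apply M a b
  rw [h]
  split_ifs <;> fun_prop

lemma continuous_columnCov (S : Matrix (Fin Nc × Fin Nt) (Fin Nc × Fin Nt) ℂ) (s : ℝ) :
    Continuous (columnCov S s : Blocks Nc Nx Nt → _) := by
  have := continuous_blkDiag (Nc := Nc) (m := Nx) (n := Nt)
  unfold columnCov
  fun_prop

lemma measurable_channelOutput {α : Type*} [MeasurableSpace α] (T : Matrix (Fin Nc × Fin Nt) κ ℂ)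
    {H : α → Blocks Nc Nt Nr} {x : α → Blocks Nc Nx Nt} {z : α → Fin Nr → κ → ℂ}
    {w : α → Blocks Nc Nx Nr} (hH : Measurable H) (hx : Measurable x) (hz : Measurable z)
    (hw : Measurable w) : Measurable fun a => channelOutput T (H a) (x a) (z a) (w a) := by
  have hb : ∀ i j, Measurable fun a => blkDiag (x a) i j := fun i j =>
    (continuous_blkDiag.matrix_elem i j).measurable.comp hx
  refine measurable_pi_lambda _ fun p => measurable_pi_lambda _ fun n =>
    measurable_pi_lambda _ fun r => ?_
  simp only [channelOutput, usefulSignal, Matrix.mulVec, dotProduct, Matrix.mul_apply]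
  fun_prop

lemma columnCov_posDef {S : Matrix (Fin Nc × Fin Nt) (Fin Nc × Fin Nt) ℂ} (hS : S.PosSemidef)
    {s : ℝ} (hs : 0 < s) (x : Blocks Nc Nx Nt) : (columnCov S s x).PosDef :=
  (hS.mul_mul_conjTranspose_same (blkDiag x)).add_smul_one_posDef hs

lemma noiseLaw_eq_withDensity {σ2 : ℝ≥0} (hσ2 : 0 < σ2) :
    noiseLaw Nc Nx Nr σ2 = volume.withDensity fun w : Blocks Nc Nx Nr => ENNReal.ofReal
      (∏ r, gaussDens (((σ2 : ℝ) : ℂ) • 1) fun a : Fin Nc × Fin Nx => w a.1 a.2 r) := by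
  have hs : (0 : ℝ) < σ2 := by exact_mod_cast hσ2
  have h1 : ∀ K : Matrix (Fin Nr) (Fin Nr) ℂ, K.PosDef → Integrable
      (fun w : Fin Nx → Fin Nr → ℂ => ∏ n, gaussDens K (w n)) := fun K hK =>
    Integrable.fintype_prod_dep fun _ => integrable_gaussDens hK
  have hK := posDef_smul_one (ι := Fin Nr) hs
  have hpos := fun y => (gaussDens_pos hK y).le
  rw [noiseLaw, pi_cscg_eq_withDensity hσ2]
  have h2 : (Measure.pi fun _ : Fin Nx => (volume : Measure (Fin Nr → ℂ)).withDensity fun z =>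
      ENNReal.ofReal (gaussDens (((σ2 : ℝ) : ℂ) • (1 : Matrix (Fin Nr) (Fin Nr) ℂ)) z))
      = volume.withDensity fun w => ENNReal.ofReal (∏ n, gaussDens (((σ2 : ℝ) : ℂ) • 1) (w n)) :=
    pi_withDensity_ofReal _ (fun _ z => hpos z) fun _ => integrable_gaussDens hK
  rw [h2, pi_withDensity_ofReal _ (fun _ z => Finset.prod_nonneg fun n _ => hpos _)
    fun _ => h1 _ hK]
  congr 1
  ext w
  congr 1
  simp_rw [gaussDens_smul_one hs, Fintype.prod_prod_type]
  rw [Finset.prod_comm (s := (Finset.univ : Finset (Fin Nr)))]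
  exact Finset.prod_congr rfl fun p _ => Finset.prod_comm

variable [DecidableEq κ]

lemma hasCov_stdCscg : HasCov (stdCscg κ) (fun k z => z k) 1 := by
  have h := (((hasCov_cscg 1).pi_smul_one (κ := κ))).reindex fun k => (k, ())
  convert! h using 1
  ext a b
  simp [Matrix.one_apply]

lemma hasCov_interferenceLaw {ι : Type*} (M : Matrix ι κ ℂ) :
    HasCov (interferenceLaw Nr κ) (fun (b : Fin Nr × ι) z => (M *ᵥ z b.1) b.2)
      (Matrix.of fun a b => if a.1 = b.1 then (M * Mᴴ) a.2 b.2 else 0) := by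
  have h := hasCov_stdCscg.linear M
  rw [Matrix.mul_one] at h
  exact HasCov.pi fun _ : Fin Nr => h

lemma hasCov_noiseLaw (σ2 : ℝ≥0) :
    HasCov (noiseLaw Nc Nx Nr σ2) (fun (b : Fin Nr × Fin Nc × Fin Nx) w => w b.2.1 b.2.2 b.1)
      (((σ2 : ℝ) : ℂ) • 1) := by
  have h := ((((hasCov_cscg σ2).pi_smul_one (κ := Fin Nr)).pi_smul_one (κ := Fin Nx)).pi_smul_one
    (κ := Fin Nc)).reindex fun b : Fin Nr × Fin Nc × Fin Nx => (b.2.1, b.2.2, b.1, ())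
  convert! h using 1
  ext a b
  simp only [Matrix.smul_apply, Matrix.one_apply, Matrix.submatrix_apply, Prod.ext_iff]
  congr 1
  exact if_congr (by simp; tauto) rfl rfl

/-- Given `X = x`, distinct columns of interference plus noise are uncorrelated, and each has the
covariance matrix `columnCov`. -/
lemma hasCov_interference_add_noise (T : Matrix (Fin Nc × Fin Nt) κ ℂ) (σ2 : ℝ≥0)
    (x : Blocks Nc Nx Nt) :
    HasCov ((interferenceLaw Nr κ).prod (noiseLaw Nc Nx Nr σ2))
      (fun (b : Fin Nr × Fin Nc × Fin Nx) zw =>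
        ((blkDiag x * T) *ᵥ zw.1 b.1) b.2 + zw.2 b.2.1 b.2.2 b.1)
      (Matrix.of fun a b => if a.1 = b.1 then columnCov (T * Tᴴ) σ2 x a.2 b.2 else 0) := by
  convert! (hasCov_interferenceLaw (blkDiag x * T)).add_prod (hasCov_noiseLaw σ2) using 1
  ext a b
  simp only [columnCov, Matrix.add_apply, Matrix.of_apply, Matrix.smul_apply, Matrix.one_apply,
    Prod.ext_iff (x := a), Matrix.conjTranspose_mul, Matrix.mul_assoc]
  by_cases h : a.1 = b.1 <;> simp [h]

lemma hasCov_column (T : Matrix (Fin Nc × Fin Nt) κ ℂ) (σ2 : ℝ≥0) (x : Blocks Nc Nx Nt)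
    (r : Fin Nr) :
    HasCov ((interferenceLaw Nr κ).prod (noiseLaw Nc Nx Nr σ2))
      (fun (a : Fin Nc × Fin Nx) zw => ((blkDiag x * T) *ᵥ zw.1 r) a + zw.2 a.1 a.2 r)
      (columnCov (T * Tᴴ) σ2 x) := by
  convert! (hasCov_interference_add_noise T σ2 x).reindex fun a => (r, a) using 1
  ext a b
  simp

lemma hasCov_row (T : Matrix (Fin Nc × Fin Nt) κ ℂ) (σ2 : ℝ≥0) (x : Blocks Nc Nx Nt)
    (p : Fin Nc) (n : Fin Nx) :
    HasCov ((interferenceLaw Nr κ).prod (noiseLaw Nc Nx Nr σ2))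
      (fun (r : Fin Nr) zw => ((blkDiag x * T) *ᵥ zw.1 r) (p, n) + zw.2 p n r)
      (columnCov (T * Tᴴ) σ2 x (p, n) (p, n) • 1) := by
  convert! (hasCov_interference_add_noise T σ2 x).reindex fun r => (r, (p, n)) using 1
  ext a b
  simp [Matrix.one_apply]

/-- The conditional density of the received signal given `X = x`. -/
def outputDens (S : Matrix (Fin Nc × Fin Nt) (Fin Nc × Fin Nt) ℂ) (s : ℝ) (H : Blocks Nc Nt Nr)
    (a : Blocks Nc Nx Nt × Blocks Nc Nx Nr) : ℝ :=
  ∏ r, gaussDens (columnCov S s a.1) fun b => a.2 b.1 b.2 r - usefulSignal a.1 H b.1 b.2 r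

lemma measurable_quadForm_inv {α β ι : Type*} [Fintype ι] [DecidableEq ι] [TopologicalSpace β]
    [MeasurableSpace α] [MeasurableSpace β] [OpensMeasurableSpace β] {A : β → Matrix ι ι ℂ}
    (hA : Continuous A) {g : α → β} (hg : Measurable g) {f : α → ι → ℂ} (hf : Measurable f) :
    Measurable fun a => quadForm (A (g a))⁻¹ (f a) := by
  have h : ∀ i j, Measurable fun a => (A (g a))⁻¹ i j := fun i j => by
    simp only [Matrix.inv_def, Ring.inverse_eq_inv', Matrix.smul_apply, smul_eq_mul]
    have h1 : Measurable fun a => (A (g a)).det := hA.matrix_det.measurable.comp hg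
    have h2 : Measurable fun a => (A (g a)).adjugate i j :=
      (hA.matrix_adjugate.matrix_elem i j).measurable.comp hg
    exact h1.inv.mul h2
  have hfi : ∀ i, Measurable fun a => f a i := fun i => (measurable_pi_apply i).comp hf
  have hfs : ∀ i, Measurable fun a => star (f a i) := fun i =>
    continuous_star.measurable.comp (hfi i)
  unfold quadForm dotProduct Matrix.mulVec dotProduct
  simp only [Pi.star_apply]
  exact Complex.measurable_re.comp (Finset.measurable_fun_sum _ fun i _ => (hfs i).mul
    (Finset.measurable_fun_sum _ fun j _ => (h i j).mul (hfi j)))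

lemma measurable_gaussDens_comp {α β ι : Type*} [Fintype ι] [DecidableEq ι] [TopologicalSpace β]
    [MeasurableSpace α] [MeasurableSpace β] [OpensMeasurableSpace β] {A : β → Matrix ι ι ℂ}
    (hA : Continuous A) {g : α → β} (hg : Measurable g) {f : α → ι → ℂ} (hf : Measurable f) :
    Measurable fun a => gaussDens (A (g a)) (f a) := by
  have h1 : Measurable fun a => (A (g a)).det.re :=
    (Complex.continuous_re.comp hA.matrix_det).measurable.comp hg
  have h2 := measurable_quadForm_inv hA hg hf
  unfold gaussDens
  fun_prop

lemma measurable_outputDens (S : Matrix (Fin Nc × Fin Nt) (Fin Nc × Fin Nt) ℂ) (s : ℝ)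
    (H : Blocks Nc Nt Nr) :
    Measurable (outputDens S s H : Blocks Nc Nx Nt × Blocks Nc Nx Nr → ℝ) := by
  refine Finset.measurable_fun_prod _ fun r _ => measurable_gaussDens_comp
    (continuous_columnCov S s) measurable_fst ?_
  refine measurable_pi_lambda _ fun b => ?_
  unfold usefulSignal
  fun_prop

/-- Averaging the noise density over the interference gives `outputDens`. -/
lemma lintegral_noise_density (T : Matrix (Fin Nc × Fin Nt) κ ℂ) {s : ℝ} (hs : 0 < s)
    (H : Blocks Nc Nt Nr) (x : Blocks Nc Nx Nt) (y : Blocks Nc Nx Nr) :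
    ∫⁻ z, ENNReal.ofReal (∏ r, gaussDens ((s : ℂ) • 1) fun a : Fin Nc × Fin Nx =>
        (y a.1 a.2 r - usefulSignal x H a.1 a.2 r) - ((blkDiag x * T) *ᵥ z r) a)
        ∂interferenceLaw Nr κ
      = ENNReal.ofReal (outputDens (T * Tᴴ) s H (x, y)) := by
  have hK := posDef_smul_one (ι := Fin Nc × Fin Nx) hs
  have hint : ∀ r, Integrable (fun z : κ → ℂ => gaussDens ((s : ℂ) • 1)
      fun a : Fin Nc × Fin Nx => (y a.1 a.2 r - usefulSignal x H a.1 a.2 r)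
        - ((blkDiag x * T) *ᵥ z) a) (stdCscg κ) := fun r =>
    integrable_gaussDens_comp hK (by unfold Matrix.mulVec dotProduct; fun_prop)
  rw [interferenceLaw, ← ofReal_integral_eq_lintegral_ofReal (Integrable.fintype_prod_dep hint)
    (.of_forall fun z => Finset.prod_nonneg fun r _ => (gaussDens_pos hK _).le),
    integral_fintype_prod_eq_prod (f := fun r (z : κ → ℂ) => gaussDens ((s : ℂ) • 1)
      fun a : Fin Nc × Fin Nx => (y a.1 a.2 r - usefulSignal x H a.1 a.2 r)
        - ((blkDiag x * T) *ᵥ z) a)]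
  congr 1
  refine Finset.prod_congr rfl fun r _ => ?_
  have h := integral_gaussDens_sub_mulVec (blkDiag x * T) hs
    fun a => y a.1 a.2 r - usefulSignal x H a.1 a.2 r
  rw [Matrix.conjTranspose_mul, ← Matrix.mul_assoc, Matrix.mul_assoc (blkDiag x) T] at h
  exact h

/-- The joint law of `(x, g(x, z) + w)` for independent `x`, `z`, `w`, where `w` has a density with
respect to a translation-invariant measure. -/
lemma map_add_eq_withDensity {α γ E : Type*} [MeasurableSpace α] [MeasurableSpace γ]
    [MeasurableSpace E] [AddCommGroup E] [MeasurableAdd₂ E] [MeasurableNeg E] [MeasurableSub₂ E]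
    (P : Measure α) (Q : Measure γ) (ν : Measure E) [SFinite P] [SFinite Q] [SigmaFinite ν]
    [ν.IsAddRightInvariant] {φ : E → ℝ≥0∞} (hφ : Measurable φ) {g : α × γ → E}
    (hg : Measurable g) :
    (P.prod (Q.prod (ν.withDensity φ))).map (fun a => (a.1, g (a.1, a.2.1) + a.2.2))
      = (P.prod ν).withDensity fun a => ∫⁻ z, φ (a.2 - g (a.1, z)) ∂Q := by
  have hd : Measurable fun a : α × E => ∫⁻ z, φ (a.2 - g (a.1, z)) ∂Q :=
    Measurable.lintegral_prod_right' (f := fun b : (α × E) × γ => φ (b.1.2 - g (b.1.1, b.2)))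
      (by fun_prop)
  refine Measure.ext_of_lintegral _ fun F hF => ?_
  rw [lintegral_map hF (by fun_prop), lintegral_prod _ (by fun_prop),
    lintegral_withDensity_eq_lintegral_mul _ hd hF, lintegral_prod _ (hd.mul hF).aemeasurable]
  refine lintegral_congr fun x => ?_
  rw [lintegral_prod _ (by fun_prop)]
  have hinner : ∀ z, ∫⁻ w, F (x, g (x, z) + w) ∂(ν.withDensity φ)
      = ∫⁻ y, φ (y - g (x, z)) * F (x, y) ∂ν := by
    intro z
    rw [lintegral_withDensity_eq_lintegral_mul _ hφ (by fun_prop),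
      ← lintegral_sub_right_eq_self _ (g (x, z))]
    simp
  simp_rw [hinner]
  rw [lintegral_lintegral_swap (by fun_prop)]
  refine lintegral_congr fun y => ?_
  rw [lintegral_mul_const _ (by fun_prop), Pi.mul_apply]

lemma map_channelOutput_eq_withDensity (PX : Measure (Blocks Nc Nx Nt)) [IsProbabilityMeasure PX]
    (T : Matrix (Fin Nc × Fin Nt) κ ℂ) {σ2 : ℝ≥0} (hσ2 : 0 < σ2) (H : Blocks Nc Nt Nr) :
    (PX.prod ((interferenceLaw Nr κ).prod (noiseLaw Nc Nx Nr σ2))).map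
        (fun a => (a.1, channelOutput T H a.1 a.2.1 a.2.2))
      = (PX.prod volume).withDensity fun a => ENNReal.ofReal (outputDens (T * Tᴴ) σ2 H a) := by
  have hs : (0 : ℝ) < σ2 := by exact_mod_cast hσ2
  have hz : Measurable fun a : Blocks Nc Nx Nt × (Fin Nr → κ → ℂ) =>
      channelOutput T H a.1 a.2 0 :=
    measurable_channelOutput T measurable_const measurable_fst measurable_snd measurable_const
  have hadd : ∀ (x : Blocks Nc Nx Nt) z w,
      channelOutput T H x z w = channelOutput T H x z 0 + w := by
    intro x z w
    ext p n r
    simp [channelOutput, add_assoc]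
  have hφ : Measurable fun w : Blocks Nc Nx Nr => ENNReal.ofReal
      (∏ r, gaussDens (((σ2 : ℝ) : ℂ) • 1) fun a : Fin Nc × Fin Nx => w a.1 a.2 r) := by
    have := continuous_gaussDens (((σ2 : ℝ) : ℂ) • (1 : Matrix (Fin Nc × Fin Nx) _ ℂ))
    fun_prop
  have h := map_add_eq_withDensity PX (interferenceLaw Nr κ)
    (volume : Measure (Blocks Nc Nx Nr)) hφ hz
  rw [← noiseLaw_eq_withDensity hσ2] at h
  have hfun : (fun a : Blocks Nc Nx Nt × (Fin Nr → κ → ℂ) × Blocks Nc Nx Nr =>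
      (a.1, channelOutput T H a.1 a.2.1 a.2.2))
      = fun a => (a.1, channelOutput T H a.1 a.2.1 0 + a.2.2) :=
    funext fun a => congrArg (Prod.mk a.1) (hadd a.1 a.2.1 a.2.2)
  rw [hfun, h]
  congr 1
  ext ⟨x, y⟩
  rw [← lintegral_noise_density T hs H x y]
  refine lintegral_congr fun z => ?_
  congr 1
  refine Finset.prod_congr rfl fun r _ => ?_
  congr 1
  ext a
  simp [channelOutput, sub_sub]

end FixedChannel

end UplinkISAC

namespace UplinkISAC

/-! ### Moments of the transmitted and of the received signal -/

section SignalMoments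

variable {Nc Nx Nt Nr : ℕ} {κ : Type*} [Fintype κ] [DecidableEq κ]
  {PX : Measure (Blocks Nc Nx Nt)}

/-- The second-moment matrix of the row `n` of the block `p` of the transmitted signal. -/
def rowMoment (PX : Measure (Blocks Nc Nx Nt)) (p : Fin Nc) (n : Fin Nx) :
    Matrix (Fin Nt) (Fin Nt) ℂ :=
  Matrix.of fun t t' => ∫ x, x p n t * star (x p n t') ∂PX

/-- The average over the symbol intervals of the second-moment matrices of the rows of the block
`p`, that is, the transpose of the diagonal block of `Σ_X` with the index `p`. -/
def avgMoment (PX : Measure (Blocks Nc Nx Nt)) (p : Fin Nc) : Matrix (Fin Nt) (Fin Nt) ℂ :=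
  Matrix.of fun t t' => sigmaX PX (fun x => x) (p, t') (p, t)

/-- The variance `tr(E[Xᴴ X] S) / Nx + s` of interference plus noise. -/
def totalNoise (PX : Measure (Blocks Nc Nx Nt)) (S : Matrix (Fin Nc × Fin Nt) (Fin Nc × Fin Nt) ℂ)
    (s : ℝ) : ℝ := (txGram PX (fun x => x) * S).trace.re / Nx + s

/-- The power that interference and noise at the subcarrier `p` put on one receive antenna, summed
over the symbol intervals. -/
def subcarrierNoise (PX : Measure (Blocks Nc Nx Nt))
    (S : Matrix (Fin Nc × Fin Nt) (Fin Nc × Fin Nt) ℂ) (s : ℝ) (p : Fin Nc) : ℝ :=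
  ∑ n, ∫ x, (columnCov S s x (p, n) (p, n)).re ∂PX

/-- The covariance matrix, at the subcarrier `p`, of the Gaussian law to which the received signal
is compared. -/
def outputCov (PX : Measure (Blocks Nc Nx Nt)) (ρ : ℝ) (H : Blocks Nc Nt Nr) (p : Fin Nc) :
    Matrix (Fin Nr) (Fin Nr) ℂ :=
  (Matrix.of (H p))ᵀ * avgMoment PX p * (Matrix.of (H p))ᵀᴴ + (ρ : ℂ) • 1

variable (hX : ∀ p n t, MemLp (fun x => x p n t) 2 PX)
include hX

lemma hasMoment_row (p : Fin Nc) (n : Fin Nx) :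
    HasMoment PX (fun t x => x p n t) (rowMoment PX p n) :=
  ⟨fun t => hX p n t, fun _ _ => rfl⟩

lemma memLp_blkDiag (a : Fin Nc × Fin Nx) (b : Fin Nc × Fin Nt) :
    MemLp (fun x : Blocks Nc Nx Nt => blkDiag x a b) 2 PX := by
  simp only [blkDiag_apply]
  split_ifs
  · exact hX _ _ _
  · exact MemLp.zero

lemma txGram_apply_eq_sum (b b' : Fin Nc × Fin Nt) :
    txGram PX (fun x => x) b' b
      = ∑ a : Fin Nc × Fin Nx, ∫ x, blkDiag x a b * star (blkDiag x a b') ∂PX := by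
  rw [← integral_finsetSum _ fun a _ =>
    (memLp_blkDiag hX a b).integrable_mul_star (memLp_blkDiag hX a b')]
  simp only [txGram, Matrix.of_apply, Matrix.mul_apply, Matrix.conjTranspose_apply]
  exact integral_congr_ae (.of_forall fun x => Finset.sum_congr rfl fun a _ => mul_comm _ _)

lemma txGram_block (p p' : Fin Nc) (t t' : Fin Nt) :
    txGram PX (fun x => x) (p', t') (p, t) = if p = p' then ∑ n, rowMoment PX p n t t' else 0 := by
  rw [txGram_apply_eq_sum hX, Fintype.sum_prod_type]
  simp only [blkDiag_apply]
  rw [Finset.sum_eq_single p (fun q _ hq => by simp [hq]) (by simp)]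
  by_cases h : p = p'
  · subst h
    simp [rowMoment]
  · simp [h]

lemma sum_rowMoment (p : Fin Nc) : ∑ n, rowMoment PX p n = (Nx : ℂ) • avgMoment PX p := by
  ext t t'
  rw [Matrix.sum_apply, Matrix.smul_apply, avgMoment, Matrix.of_apply, sigmaX, Matrix.smul_apply,
    txGram_block hX, if_pos rfl, smul_eq_mul, smul_eq_mul]
  rcases eq_or_ne Nx 0 with h | h
  · subst h; simp
  · rw [← mul_assoc, mul_inv_cancel₀ (by exact_mod_cast h), one_mul]

lemma avgMoment_posSemidef (p : Fin Nc) : (avgMoment PX p).PosSemidef := by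
  have h : avgMoment PX p = (Nx : ℂ)⁻¹ • ∑ n, rowMoment PX p n := by
    ext t t'
    rw [Matrix.smul_apply, Matrix.sum_apply, avgMoment, Matrix.of_apply, sigmaX, Matrix.smul_apply,
      txGram_block hX, if_pos rfl]
  rw [h]
  exact (Matrix.posSemidef_sum _ fun n _ => (hasMoment_row hX p n).posSemidef).smul
    (inv_nonneg.2 (Nat.cast_nonneg _))

lemma outputCov_posDef {ρ : ℝ} (hρ : 0 < ρ) (H : Blocks Nc Nt Nr) (p : Fin Nc) :
    (outputCov PX ρ H p).PosDef :=
  ((avgMoment_posSemidef hX p).mul_mul_conjTranspose_same _).add_smul_one_posDef hρ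

/-- `E[X S Xᴴ]`, entrywise on the diagonal. -/
lemma integrable_diag (S : Matrix (Fin Nc × Fin Nt) (Fin Nc × Fin Nt) ℂ) (a : Fin Nc × Fin Nx) :
    Integrable (fun x => (blkDiag x * S * (blkDiag x)ᴴ) a a) PX ∧
      ∫ x, (blkDiag x * S * (blkDiag x)ᴴ) a a ∂PX
        = ∑ b', ∑ b, S b b' * ∫ x, blkDiag x a b * star (blkDiag x a b') ∂PX := by
  have h : ∀ x : Blocks Nc Nx Nt, (blkDiag x * S * (blkDiag x)ᴴ) a a
      = ∑ b', ∑ b, S b b' * (blkDiag x a b * star (blkDiag x a b')) := by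
    intro x
    simp only [Matrix.mul_apply, Matrix.conjTranspose_apply, Finset.sum_mul]
    exact Finset.sum_congr rfl fun i _ => Finset.sum_congr rfl fun j _ => by ring
  have hi : ∀ b b', Integrable
      (fun x : Blocks Nc Nx Nt => S b b' * (blkDiag x a b * star (blkDiag x a b'))) PX :=
    fun b b' => ((memLp_blkDiag hX a b).integrable_mul_star (memLp_blkDiag hX a b')).const_mul _
  simp_rw [h]
  refine ⟨integrable_finsetSum _ fun b' _ => integrable_finsetSum _ fun b _ => hi b b', ?_⟩
  rw [integral_finsetSum _ fun b' _ => integrable_finsetSum _ fun b _ => hi b b']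
  simp_rw [integral_finsetSum _ fun b _ => hi b _, integral_const_mul]

lemma sum_integral_diag (S : Matrix (Fin Nc × Fin Nt) (Fin Nc × Fin Nt) ℂ) :
    ∑ a : Fin Nc × Fin Nx, ∫ x, (blkDiag x * S * (blkDiag x)ᴴ) a a ∂PX
      = (txGram PX (fun x => x) * S).trace := by
  simp_rw [fun a => (integrable_diag hX S a).2, Matrix.trace, Matrix.diag, Matrix.mul_apply,
    txGram_apply_eq_sum hX, Finset.sum_mul]
  rw [Finset.sum_comm]
  refine Finset.sum_congr rfl fun b' _ => ?_
  rw [Finset.sum_comm]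
  exact Finset.sum_congr rfl fun b _ => Finset.sum_congr rfl fun a _ => mul_comm _ _

variable [IsProbabilityMeasure PX] {S : Matrix (Fin Nc × Fin Nt) (Fin Nc × Fin Nt) ℂ}

lemma integrable_columnCov (s : ℝ) (a : Fin Nc × Fin Nx) :
    Integrable (fun x => columnCov S s x a a) PX := by
  simp only [columnCov, Matrix.add_apply]
  exact (integrable_diag hX S a).1.add (integrable_const _)

lemma integral_columnCov_re (s : ℝ) (a : Fin Nc × Fin Nx) :
    ∫ x, (columnCov S s x a a).re ∂PX
      = (∫ x, (blkDiag x * S * (blkDiag x)ᴴ) a a ∂PX).re + s := by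
  have h1 := integral_re (integrable_columnCov (S := S) hX s a)
  simp only [RCLike.re_eq_complex_re] at h1
  rw [h1]
  simp only [columnCov, Matrix.add_apply]
  rw [integral_add (integrable_diag hX S a).1 (integrable_const _)]
  simp

omit [IsProbabilityMeasure PX] in
lemma integral_diag_re_nonneg (hS : S.PosSemidef) (a : Fin Nc × Fin Nx) :
    0 ≤ (∫ x, (blkDiag x * S * (blkDiag x)ᴴ) a a ∂PX).re := by
  have h1 := integral_re (integrable_diag hX S a).1
  simp only [RCLike.re_eq_complex_re] at h1
  rw [← h1]
  exact integral_nonneg fun x =>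
    (Complex.nonneg_iff.1 (hS.mul_mul_conjTranspose_same (blkDiag x)).diag_nonneg).1

lemma card_mul_totalNoise (s : ℝ) :
    (Nx : ℝ) * totalNoise PX S s
      = ∑ a : Fin Nc × Fin Nx, (∫ x, (blkDiag x * S * (blkDiag x)ᴴ) a a ∂PX).re + Nx * s := by
  rw [← Complex.re_sum, sum_integral_diag hX, totalNoise, mul_add]
  rcases eq_or_ne Nx 0 with h | h
  · subst h
    have := sum_integral_diag hX S
    rw [← this]
    simp
  · rw [mul_div_cancel₀ _ (by exact_mod_cast h)]

/-- The interference at one subcarrier is dominated by that at all subcarriers together. -/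
lemma subcarrierNoise_le (hS : S.PosSemidef) (s : ℝ) (p : Fin Nc) :
    subcarrierNoise PX S s p ≤ Nx * totalNoise PX S s := by
  rw [card_mul_totalNoise hX, subcarrierNoise]
  simp_rw [integral_columnCov_re hX s]
  rw [Finset.sum_add_distrib, Fintype.sum_prod_type]
  simp only [Finset.sum_const, Finset.card_univ, Fintype.card_fin, nsmul_eq_mul]
  gcongr
  exact Finset.single_le_sum (f := fun q => ∑ n, (∫ x, (blkDiag x * S * (blkDiag x)ᴴ) (q, n) (q, n)
    ∂PX).re) (fun q _ => Finset.sum_nonneg fun n _ => integral_diag_re_nonneg hX hS _)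
    (Finset.mem_univ p)

omit [IsProbabilityMeasure PX] in
lemma totalNoise_pos (hS : S.PosSemidef) {s : ℝ} (hs : 0 < s) : 0 < totalNoise PX S s := by
  have h : 0 ≤ (txGram PX (fun x => x) * S).trace.re := by
    rw [← sum_integral_diag hX, Complex.re_sum]
    exact Finset.sum_nonneg fun a _ => integral_diag_re_nonneg hX hS a
  unfold totalNoise
  positivity

lemma integrable_log_det_columnCov (hS : S.PosSemidef) {s : ℝ} (hs : 0 < s) :
    Integrable (fun x => Real.log (columnCov S s x).det.re) PX := by
  have hm : Measurable fun x : Blocks Nc Nx Nt => Real.log (columnCov S s x).det.re :=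
    Real.measurable_log.comp
      (Complex.continuous_re.comp (continuous_columnCov S s).matrix_det).measurable
  have htr : Integrable (fun x => (columnCov S s x).trace.re) PX :=
    (integrable_finsetSum _ fun a _ => integrable_columnCov hX s a).re
  refine ((htr.abs.add (integrable_const (|(Fintype.card (Fin Nc × Fin Nx) : ℝ)|
    + |Real.log (s ^ Fintype.card (Fin Nc × Fin Nx))|)))).mono' hm.aestronglyMeasurable
    (.of_forall fun x => ?_)
  have h1 := log_det_re_le_trace (columnCov_posDef hS hs x)
  have h2 := Real.log_le_log (by positivity)
    (pow_card_le_det_re (hS.mul_mul_conjTranspose_same (blkDiag x)) hs)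
  rw [← columnCov] at h2
  have h3 := neg_abs_le (Real.log (s ^ Fintype.card (Fin Nc × Fin Nx)))
  have h4 := le_abs_self (columnCov S s x).trace.re
  have h5 := neg_abs_le (Fintype.card (Fin Nc × Fin Nx) : ℝ)
  have h6 := abs_nonneg (columnCov S s x).trace.re
  have h7 := abs_nonneg (Real.log (s ^ Fintype.card (Fin Nc × Fin Nx)))
  have h8 := abs_nonneg (Fintype.card (Fin Nc × Fin Nx) : ℝ)
  rw [Real.norm_eq_abs, Pi.add_apply, abs_le]
  constructor <;> linarith

omit hX [IsProbabilityMeasure PX] in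
lemma memLp_mul_prod {α β : Type*} [MeasurableSpace α] [MeasurableSpace β] {P : Measure α}
    {Q : Measure β} [SFinite P] [SFinite Q] {f : α → ℂ} {g : β → ℂ} (hf : MemLp f 2 P)
    (hg : MemLp g 2 Q) : MemLp (fun a : α × β => f a.1 * g a.2) 2 (P.prod Q) := by
  have hm : AEStronglyMeasurable (fun a : α × β => f a.1 * g a.2) (P.prod Q) :=
    hf.1.comp_fst.mul hg.1.comp_snd
  rw [memLp_two_iff_integrable_sq_norm hm]
  simp_rw [norm_mul, mul_pow]
  exact ((memLp_two_iff_integrable_sq_norm hf.1).1 hf).mul_prod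
    ((memLp_two_iff_integrable_sq_norm hg.1).1 hg)

/-- Second moments of a row of the received signal: the interference and the noise are centred and
uncorrelated with the transmitted signal, and have uncorrelated columns. -/
lemma hasMoment_channelOutput (T : Matrix (Fin Nc × Fin Nt) κ ℂ) (σ2 : ℝ≥0) (H : Blocks Nc Nt Nr)
    (p : Fin Nc) (n : Fin Nx) :
    HasMoment (PX.prod ((interferenceLaw Nr κ).prod (noiseLaw Nc Nx Nr σ2)))
      (fun r a => channelOutput T H a.1 a.2.1 a.2.2 p n r)
      ((Matrix.of (H p))ᵀ * rowMoment PX p n * (Matrix.of (H p))ᵀᴴ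
        + (∫ x, columnCov (T * Tᴴ) σ2 x (p, n) (p, n) ∂PX) • 1) := by
  have hus : ∀ (x : Blocks Nc Nx Nt) r,
      usefulSignal x H p n r = ((Matrix.of (H p))ᵀ *ᵥ fun t => x p n t) r := fun x r => by
    simp [usefulSignal, Matrix.mulVec, dotProduct, mul_comm]
  have hU := (hasMoment_row hX p n).linear (Matrix.of (H p))ᵀ
  simp_rw [← hus] at hU
  have hL : ∀ r, MemLp (fun a : Blocks Nc Nx Nt × (Fin Nr → κ → ℂ) × Blocks Nc Nx Nr =>
      channelOutput T H a.1 a.2.1 a.2.2 p n r) 2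
      (PX.prod ((interferenceLaw Nr κ).prod (noiseLaw Nc Nx Nr σ2))) := by
    intro r
    have h3 : MemLp (fun w : Blocks Nc Nx Nr => w p n r) 2 (noiseLaw Nc Nx Nr σ2) :=
      (hasCov_noiseLaw σ2).memLp (r, p, n)
    refine ((hU.memLp r).comp_fst _).add (MemLp.add ?_ ((h3.comp_snd _).comp_snd _))
    simp_rw [← Matrix.mulVec_mulVec]
    refine memLp_finsetSum _ fun b _ => ?_
    have h2 : MemLp (fun z : Fin Nr → κ → ℂ => (T *ᵥ z r) b) 2 (interferenceLaw Nr κ) :=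
      (hasCov_interferenceLaw T).memLp (r, b)
    exact memLp_mul_prod (memLp_blkDiag hX (p, n) b) (h2.comp_fst (noiseLaw Nc Nx Nr σ2))
  refine ⟨hL, fun r r' => ?_⟩
  rw [integral_prod _ ((hL r).integrable_mul_star (hL r'))]
  have hinner : ∀ x, ∫ zw, channelOutput T H x zw.1 zw.2 p n r
        * star (channelOutput T H x zw.1 zw.2 p n r')
        ∂((interferenceLaw Nr κ).prod (noiseLaw Nc Nx Nr σ2))
      = usefulSignal x H p n r * star (usefulSignal x H p n r')
        + columnCov (T * Tᴴ) σ2 x (p, n) (p, n) * (1 : Matrix (Fin Nr) (Fin Nr) ℂ) r r' := by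
    intro x
    have h := ((hasCov_row T σ2 x p n).const_add (usefulSignal x H p n)).integral_mul_star r r'
    rw [Matrix.add_apply, Matrix.vecMulVec_apply, Matrix.smul_apply, Pi.star_apply,
      smul_eq_mul] at h
    exact h
  simp_rw [hinner]
  rw [integral_add (hU.integrable r r') ((integrable_columnCov hX _ _).mul_const _),
    hU.integral_mul_star, integral_mul_const]
  simp

/-- Average of the quadratic form in a received row that belongs to the comparison law. -/
lemma integral_quadForm_channelOutput {T : Matrix (Fin Nc × Fin Nt) κ ℂ} {σ2 : ℝ≥0} {ρ : ℝ}
    (hρ : 0 < ρ) (H : Blocks Nc Nt Nr) :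
    Integrable (fun a : Blocks Nc Nx Nt × (Fin Nr → κ → ℂ) × Blocks Nc Nx Nr => ∑ p, ∑ n,
        quadForm (outputCov PX ρ H p)⁻¹ (channelOutput T H a.1 a.2.1 a.2.2 p n))
      (PX.prod ((interferenceLaw Nr κ).prod (noiseLaw Nc Nx Nr σ2))) ∧
    ∫ a, ∑ p, ∑ n, quadForm (outputCov PX ρ H p)⁻¹ (channelOutput T H a.1 a.2.1 a.2.2 p n)
        ∂(PX.prod ((interferenceLaw Nr κ).prod (noiseLaw Nc Nx Nr σ2)))
      = ∑ p, (Nx * Nr - (Nx * ρ - subcarrierNoise PX (T * Tᴴ) σ2 p)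
          * (outputCov PX ρ H p)⁻¹.trace.re) := by
  have h := fun p n => (hasMoment_channelOutput hX T σ2 H p n).integral_quadForm
    (outputCov PX ρ H p)⁻¹
  refine ⟨integrable_finsetSum _ fun p _ => integrable_finsetSum _ fun n _ => (h p n).1, ?_⟩
  rw [integral_finsetSum _ fun p _ => integrable_finsetSum _ fun n _ => (h p n).1]
  refine Finset.sum_congr rfl fun p _ => ?_
  rw [integral_finsetSum _ fun n _ => (h p n).1]
  simp_rw [fun n => (h p n).2]
  have hA := (avgMoment_posSemidef hX p).mul_mul_conjTranspose_same (Matrix.of (H p))ᵀ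
  have htr := trace_inv_add_smul_one hA hρ
  rw [← outputCov, Fintype.card_fin] at htr
  have hre : ∀ n, (∫ x, columnCov (T * Tᴴ) σ2 x (p, n) (p, n) ∂PX)
      = ((∫ x, (columnCov (T * Tᴴ) σ2 x (p, n) (p, n)).re ∂PX : ℝ) : ℂ) := by
    intro n
    rw [← integral_complex_ofReal]
    refine integral_congr_ae (.of_forall fun x => ?_)
    have hpsd : (columnCov (T * Tᴴ) σ2 x).PosSemidef :=
      ((Matrix.posSemidef_self_mul_conjTranspose T).mul_mul_conjTranspose_same _).add
        (Matrix.PosSemidef.one.smul (by exact_mod_cast σ2.coe_nonneg))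
    exact Complex.ext rfl (by
      simpa using (Complex.nonneg_iff.1 (hpsd.diag_nonneg (i := (p, n)))).2.symm)
  simp_rw [hre, Matrix.mul_add, Matrix.trace_add, Complex.add_re, Matrix.mul_smul, Matrix.mul_one,
    Matrix.trace_smul, smul_eq_mul, Complex.re_ofReal_mul]
  rw [Finset.sum_add_distrib, ← Finset.sum_mul, ← Complex.re_sum, ← Matrix.trace_sum,
    ← Matrix.mul_sum, ← Matrix.sum_mul, ← Matrix.mul_sum, sum_rowMoment hX, Matrix.mul_smul,
    Matrix.smul_mul, Matrix.mul_smul, Matrix.trace_smul, smul_eq_mul, ← Complex.ofReal_natCast,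
    Complex.re_ofReal_mul, htr, ← subcarrierNoise]
  ring

omit hX in
/-- Given `X = x`, the quadratic form in a column of interference plus noise that belongs to its
own covariance matrix averages to the dimension. -/
lemma integral_quadForm_column {T : Matrix (Fin Nc × Fin Nt) κ ℂ} {σ2 : ℝ≥0} (hσ2 : 0 < σ2)
    (r : Fin Nr) :
    Integrable (fun a : Blocks Nc Nx Nt × (Fin Nr → κ → ℂ) × Blocks Nc Nx Nr =>
        quadForm (columnCov (T * Tᴴ) σ2 a.1)⁻¹
          fun b => ((blkDiag a.1 * T) *ᵥ a.2.1 r) b + a.2.2 b.1 b.2 r)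
      (PX.prod ((interferenceLaw Nr κ).prod (noiseLaw Nc Nx Nr σ2))) ∧
    ∫ a, quadForm (columnCov (T * Tᴴ) σ2 a.1)⁻¹
          (fun b => ((blkDiag a.1 * T) *ᵥ a.2.1 r) b + a.2.2 b.1 b.2 r)
        ∂(PX.prod ((interferenceLaw Nr κ).prod (noiseLaw Nc Nx Nr σ2))) = Nc * Nx := by
  have hcol := fun x : Blocks Nc Nx Nt => (hasCov_column (Nr := Nr) T σ2 x
    r).integral_quadForm (columnCov (T * Tᴴ) σ2 x)⁻¹
  have hpd := fun x : Blocks Nc Nx Nt =>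
    columnCov_posDef (Matrix.posSemidef_self_mul_conjTranspose T) (NNReal.coe_pos.2 hσ2) x
  have hval : ∀ x, ∫ zw, quadForm (columnCov (T * Tᴴ) σ2 x)⁻¹
      (fun b => ((blkDiag x * T) *ᵥ zw.1 r) b + zw.2 b.1 b.2 r)
      ∂((interferenceLaw Nr κ).prod (noiseLaw Nc Nx Nr σ2)) = Nc * Nx := by
    intro x
    rw [(hcol x).2, Matrix.nonsing_inv_mul _ ((Matrix.isUnit_iff_isUnit_det _).1 (hpd x).isUnit),
      Matrix.trace_one]
    simp
  have hm : Measurable fun a : Blocks Nc Nx Nt × (Fin Nr → κ → ℂ) × Blocks Nc Nx Nr =>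
      quadForm (columnCov (T * Tᴴ) σ2 a.1)⁻¹
        fun b => ((blkDiag a.1 * T) *ᵥ a.2.1 r) b + a.2.2 b.1 b.2 r := by
    refine measurable_quadForm_inv (continuous_columnCov _ _) measurable_fst ?_
    have hb : ∀ i j, Measurable fun a : Blocks Nc Nx Nt × (Fin Nr → κ → ℂ) × Blocks Nc Nx Nr =>
        blkDiag a.1 i j := fun i j =>
      (continuous_blkDiag.matrix_elem i j).measurable.comp measurable_fst
    simp only [Matrix.mulVec, dotProduct, Matrix.mul_apply]
    fun_prop
  have hint := (integrable_prod_iff hm.aestronglyMeasurable).2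
    ⟨.of_forall fun x => (hcol x).1, by
      simp_rw [Real.norm_of_nonneg (quadForm_nonneg (hpd _).inv.posSemidef _)]
      simp_rw [hval]
      exact integrable_const (μ := PX) _⟩
  refine ⟨hint, ?_⟩
  rw [integral_prod _ hint]
  simp only [hval]
  simp

end SignalMoments

end UplinkISAC

namespace UplinkISAC

/-! ### Gaussian vectors with a singular covariance matrix -/

instance {m : ℕ} (S : Matrix (Fin m) (Fin m) ℂ) : IsProbabilityMeasure (cscgVector S) :=
  Measure.isProbabilityMeasure_map (continuous_const.matrix_mulVec continuous_id).aemeasurable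

lemma sqrt_mul_conjTranspose_sqrt {m : ℕ} {S : Matrix (Fin m) (Fin m) ℂ} (hS : S.PosSemidef) :
    CFC.sqrt S * (CFC.sqrt S)ᴴ = S := by
  rw [(Matrix.nonneg_iff_posSemidef.1 (CFC.sqrt_nonneg S)).isHermitian.eq,
    CFC.sqrt_mul_sqrt_self S (Matrix.nonneg_iff_posSemidef.2 hS)]

lemma hasCov_cscgVector {m : ℕ} {S : Matrix (Fin m) (Fin m) ℂ} (hS : S.PosSemidef) :
    HasCov (cscgVector S) (fun i x => x i) S := by
  have h := (hasCov_stdCscg (κ := Fin m)).linear (CFC.sqrt S)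
  rw [Matrix.mul_one, sqrt_mul_conjTranspose_sqrt hS] at h
  exact HasCov.map (continuous_const.matrix_mulVec continuous_id).aemeasurable measurable_pi_apply h

lemma integral_gaussDens_sub_mulVec_cscgVector {m : ℕ} {ι : Type*} [Fintype ι] [DecidableEq ι]
    {S : Matrix (Fin m) (Fin m) ℂ} (hS : S.PosSemidef) {s : ℝ} (hs : 0 < s) (M : Matrix ι (Fin m) ℂ)
    (y : ι → ℂ) :
    ∫ x, gaussDens ((s : ℂ) • 1) (y - M *ᵥ x) ∂cscgVector S
      = gaussDens (M * S * Mᴴ + (s : ℂ) • 1) y := by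
  have hc := continuous_gaussDens ((s : ℂ) • (1 : Matrix ι ι ℂ))
  have hm : Measurable fun z : Fin m → ℂ => CFC.sqrt S *ᵥ z :=
    (continuous_const.matrix_mulVec continuous_id).measurable
  rw [cscgVector, integral_map hm.aemeasurable
    (Continuous.aestronglyMeasurable (by unfold Matrix.mulVec dotProduct; fun_prop))]
  have h := integral_gaussDens_sub_mulVec (M * CFC.sqrt S) hs y
  rw [Matrix.conjTranspose_mul, Matrix.mul_assoc, ← Matrix.mul_assoc (CFC.sqrt S),
    sqrt_mul_conjTranspose_sqrt hS, ← Matrix.mul_assoc] at h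
  simp_rw [← Matrix.mulVec_mulVec] at h
  exact h

/-! ### Bounds on the mutual information for a fixed communication channel -/

section FixedChannelBounds

variable {Nc Nx Nt Nr : ℕ} {κ : Type*} [Fintype κ] [DecidableEq κ]
  {PX : Measure (Blocks Nc Nx Nt)}

/-- The density of the comparison law of the received signal: the rows of all blocks are
independent, and those of the block `p` have the law `CN(0, outputCov p)`. -/
def comparisonDens (PX : Measure (Blocks Nc Nx Nt)) (ρ : ℝ) (H : Blocks Nc Nt Nr)
    (y : Blocks Nc Nx Nr) : ℝ := ∏ p, ∏ n, gaussDens (outputCov PX ρ H p) (y p n)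

lemma measurable_comparisonDens (ρ : ℝ) (H : Blocks Nc Nt Nr) :
    Measurable (comparisonDens PX ρ H) := by
  have := fun p => (continuous_gaussDens (outputCov PX ρ H p)).measurable
  unfold comparisonDens
  fun_prop

lemma integral_neg_add_add_add {α : Type*} [MeasurableSpace α] {P : Measure α} {f g h k : α → ℝ}
    (hf : Integrable f P) (hg : Integrable g P) (hh : Integrable h P) (hk : Integrable k P) :
    ∫ a, (-(f a + g a) + (h a + k a)) ∂P
      = -(∫ a, f a ∂P + ∫ a, g a ∂P) + (∫ a, h a ∂P + ∫ a, k a ∂P) := by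
  rw [integral_add (f := fun a => -(f a + g a)) (g := fun a => h a + k a) (hf.add hg).neg
    (hh.add hk), integral_neg fun a => f a + g a, integral_add hf hg, integral_add hh hk]

lemma integral_sub_add {α : Type*} [MeasurableSpace α] {P : Measure α} {f g h : α → ℝ}
    (hf : Integrable f P) (hg : Integrable g P) (hh : Integrable h P) :
    ∫ a, (f a - g a + h a) ∂P = ∫ a, f a ∂P - ∫ a, g a ∂P + ∫ a, h a ∂P := by
  rw [integral_add (f := fun a => f a - g a) (hf.sub hg) hh, integral_sub hf hg]

/-- The joint law of the transmitted and the received signal for a fixed channel. -/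
def jointLaw (PX : Measure (Blocks Nc Nx Nt)) (T : Matrix (Fin Nc × Fin Nt) κ ℂ) (σ2 : ℝ≥0)
    (H : Blocks Nc Nt Nr) : Measure (Blocks Nc Nx Nt × Blocks Nc Nx Nr) :=
  (PX.prod ((interferenceLaw Nr κ).prod (noiseLaw Nc Nx Nr σ2))).map
    fun a => (a.1, channelOutput T H a.1 a.2.1 a.2.2)

omit [DecidableEq κ] in
lemma measurable_jointMap (T : Matrix (Fin Nc × Fin Nt) κ ℂ) (H : Blocks Nc Nt Nr) :
    Measurable fun a : Blocks Nc Nx Nt × (Fin Nr → κ → ℂ) × Blocks Nc Nx Nr =>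
      (a.1, channelOutput T H a.1 a.2.1 a.2.2) :=
  measurable_fst.prodMk (measurable_channelOutput T measurable_const measurable_fst
    (measurable_fst.comp measurable_snd) (measurable_snd.comp measurable_snd))

instance [IsProbabilityMeasure PX] (T : Matrix (Fin Nc × Fin Nt) κ ℂ) (σ2 : ℝ≥0)
    (H : Blocks Nc Nt Nr) : IsProbabilityMeasure (jointLaw PX T σ2 H) :=
  Measure.isProbabilityMeasure_map (measurable_jointMap T H).aemeasurable

omit [DecidableEq κ] in
lemma fst_jointLaw [IsProbabilityMeasure PX] (T : Matrix (Fin Nc × Fin Nt) κ ℂ) (σ2 : ℝ≥0)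
    (H : Blocks Nc Nt Nr) : (jointLaw PX T σ2 H).fst = PX := by
  rw [jointLaw, Measure.fst, Measure.map_map measurable_fst (measurable_jointMap T H)]
  exact measurePreserving_fst.map_eq

variable (hX : ∀ p n t, MemLp (fun x => x p n t) 2 PX)
include hX

lemma comparisonDens_pos {ρ : ℝ} (hρ : 0 < ρ) (H : Blocks Nc Nt Nr) (y : Blocks Nc Nx Nr) :
    0 < comparisonDens PX ρ H y :=
  Finset.prod_pos fun p _ => Finset.prod_pos fun _ _ => gaussDens_pos (outputCov_posDef hX hρ H p) _

lemma log_comparisonDens {ρ : ℝ} (hρ : 0 < ρ) (H : Blocks Nc Nt Nr) (y : Blocks Nc Nx Nr) :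
    Real.log (comparisonDens PX ρ H y) = -(Nc * Nx * Nr * Real.log Real.pi)
      - Nx * ∑ p, Real.log (outputCov PX ρ H p).det.re
      - ∑ p, ∑ n, quadForm (outputCov PX ρ H p)⁻¹ (y p n) := by
  have hB := outputCov_posDef hX hρ H
  rw [comparisonDens, Real.log_prod fun p _ => (Finset.prod_pos fun _ _ =>
    gaussDens_pos (hB p) _).ne']
  simp_rw [Real.log_prod fun n _ => (gaussDens_pos (hB _) (y _ n)).ne', log_gaussDens (hB _),
    Finset.sum_sub_distrib]
  simp only [Finset.sum_const, Finset.card_univ, Fintype.card_fin, nsmul_eq_mul, ← Finset.mul_sum]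
  ring

lemma isProbabilityMeasure_comparison {ρ : ℝ} (hρ : 0 < ρ) (H : Blocks Nc Nt Nr) :
    IsProbabilityMeasure ((volume : Measure (Blocks Nc Nx Nr)).withDensity fun y =>
      ENNReal.ofReal (comparisonDens PX ρ H y)) := by
  have hB := outputCov_posDef hX hρ H
  have h1 : ∀ p, Integrable (fun w : Fin Nx → Fin Nr → ℂ => ∏ n, gaussDens (outputCov PX ρ H p)
      (w n)) := fun p => Integrable.fintype_prod_dep fun _ => integrable_gaussDens (hB p)
  have h2 : Integrable (comparisonDens PX ρ H) := Integrable.fintype_prod_dep h1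
  refine ⟨?_⟩
  rw [withDensity_apply _ .univ, setLIntegral_univ, ← ofReal_integral_eq_lintegral_ofReal h2
    (.of_forall fun y => (comparisonDens_pos hX hρ H y).le)]
  have h3 : ∫ y, comparisonDens PX ρ H y = 1 := by
    have h4 := integral_fintype_prod_volume_eq_prod (fun p (w : Fin Nx → Fin Nr → ℂ) =>
      ∏ n, gaussDens (outputCov PX ρ H p) (w n))
    refine h4.trans (Finset.prod_eq_one fun p _ => ?_)
    rw [integral_fintype_prod_volume_eq_prod (fun (_ : Fin Nx) (w : Fin Nr → ℂ) =>
      gaussDens (outputCov PX ρ H p) w)]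
    exact Finset.prod_eq_one fun n _ => integral_gaussDens (hB p)
  rw [h3, ENNReal.ofReal_one]

variable [IsProbabilityMeasure PX] {T : Matrix (Fin Nc × Fin Nt) κ ℂ} {σ2 : ℝ≥0}

omit [DecidableEq κ] hX [IsProbabilityMeasure PX] in
lemma outputDens_pos (hσ2 : 0 < σ2) (H : Blocks Nc Nt Nr) (a : Blocks Nc Nx Nt × Blocks Nc Nx Nr) :
    0 < outputDens (T * Tᴴ) σ2 H a :=
  Finset.prod_pos fun _ _ => gaussDens_pos (columnCov_posDef
    (Matrix.posSemidef_self_mul_conjTranspose T) (NNReal.coe_pos.2 hσ2) a.1) _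

omit hX [IsProbabilityMeasure PX] [DecidableEq κ] in
lemma log_outputDens (hσ2 : 0 < σ2) (H : Blocks Nc Nt Nr) (x : Blocks Nc Nx Nt)
    (z : Fin Nr → κ → ℂ) (w : Blocks Nc Nx Nr) :
    Real.log (outputDens (T * Tᴴ) σ2 H (x, channelOutput T H x z w))
      = -(Nc * Nx * Nr * Real.log Real.pi)
        - Nr * Real.log (columnCov (T * Tᴴ) σ2 x).det.re
        - ∑ r, quadForm (columnCov (T * Tᴴ) σ2 x)⁻¹
            fun b => ((blkDiag x * T) *ᵥ z r) b + w b.1 b.2 r := by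
  have hK := columnCov_posDef (Matrix.posSemidef_self_mul_conjTranspose T)
    (NNReal.coe_pos.2 hσ2) x
  rw [outputDens, Real.log_prod fun r _ => (gaussDens_pos hK _).ne']
  simp_rw [log_gaussDens hK, Finset.sum_sub_distrib]
  simp only [Finset.sum_const, Finset.card_univ, Fintype.card_fin, Fintype.card_prod, nsmul_eq_mul,
    channelOutput, add_sub_cancel_left, Nat.cast_mul]
  ring

/-- The upper bound for a fixed channel: by `klDiv_fst_prod_snd_le` the mutual information is at
most the divergence of the joint law from the product of the law of `X` with the comparison law,
and that divergence is computed from the two densities. -/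
lemma klDiv_jointLaw_le (hσ2 : 0 < σ2) (H : Blocks Nc Nt Nr) :
    klDiv (jointLaw PX T σ2 H) (PX.prod (jointLaw PX T σ2 H).snd)
        ≤ ENNReal.ofReal (Nx * ∑ p, Real.log
            (outputCov PX (totalNoise PX (T * Tᴴ) σ2) H p).det.re
          - Nr * ∫ x, Real.log (columnCov (T * Tᴴ) σ2 x).det.re ∂PX) ∧
      0 ≤ Nx * ∑ p, Real.log (outputCov PX (totalNoise PX (T * Tᴴ) σ2) H p).det.re
          - Nr * ∫ x, Real.log (columnCov (T * Tᴴ) σ2 x).det.re ∂PX := by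
  have hs : (0 : ℝ) < σ2 := NNReal.coe_pos.2 hσ2
  have hS := Matrix.posSemidef_self_mul_conjTranspose T
  set ρ := totalNoise PX (T * Tᴴ) σ2 with hρdef
  have hρ : 0 < ρ := totalNoise_pos hX hS hs
  have hdens := map_channelOutput_eq_withDensity PX T hσ2 H
  rw [← jointLaw] at hdens
  have hQ := isProbabilityMeasure_comparison hX hρ H
  have hqm : Measurable fun y => ENNReal.ofReal (comparisonDens PX ρ H y) :=
    (measurable_comparisonDens ρ H).ennreal_ofReal
  have hprod : PX.prod ((volume : Measure (Blocks Nc Nx Nr)).withDensity fun y =>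
      ENNReal.ofReal (comparisonDens PX ρ H y))
      = (PX.prod volume).withDensity fun a => ENNReal.ofReal (comparisonDens PX ρ H a.2) :=
    prod_withDensity_right hqm
  have hP' : IsProbabilityMeasure ((PX.prod volume).withDensity fun a =>
      ENNReal.ofReal (outputDens (T * Tᴴ) σ2 H a)) := by rw [← hdens]; infer_instance
  have hQ' : IsProbabilityMeasure ((PX.prod volume).withDensity fun a =>
      ENNReal.ofReal (comparisonDens PX ρ H a.2)) := by rw [← hprod]; infer_instance
  -- The log-likelihood ratio, as a function of the transmitted signal, interference and noise.
  have hcol := integral_quadForm_column (PX := PX) (Nr := Nr) (T := T) hσ2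
  have hrow := integral_quadForm_channelOutput (T := T) (σ2 := σ2) hX hρ H
  have hlog := (integrable_log_det_columnCov hX hS hs).comp_fst
    ((interferenceLaw Nr κ).prod (noiseLaw Nc Nx Nr σ2))
  have hint0 := ((hlog.const_mul (Nr : ℝ)).add
    (integrable_finsetSum Finset.univ fun r _ => (hcol r).1)).neg.add
    ((integrable_const (Nx * ∑ p, Real.log (outputCov PX ρ H p).det.re)).add hrow.1)
  have hllr : ∀ a : Blocks Nc Nx Nt × (Fin Nr → κ → ℂ) × Blocks Nc Nx Nr,
      Real.log (outputDens (T * Tᴴ) σ2 H (a.1, channelOutput T H a.1 a.2.1 a.2.2))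
        - Real.log (comparisonDens PX ρ H (channelOutput T H a.1 a.2.1 a.2.2))
      = -(Nr * Real.log (columnCov (T * Tᴴ) σ2 a.1).det.re
          + ∑ r, quadForm (columnCov (T * Tᴴ) σ2 a.1)⁻¹
            fun b => ((blkDiag a.1 * T) *ᵥ a.2.1 r) b + a.2.2 b.1 b.2 r)
        + (Nx * ∑ p, Real.log (outputCov PX ρ H p).det.re
          + ∑ p, ∑ n, quadForm (outputCov PX ρ H p)⁻¹ (channelOutput T H a.1 a.2.1 a.2.2 p n)) := by
    intro a
    rw [log_outputDens hσ2, log_comparisonDens hX hρ]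
    ring
  have hllrm : Measurable fun a => Real.log (outputDens (T * Tᴴ) σ2 H a)
      - Real.log (comparisonDens PX ρ H a.2) :=
    (measurable_outputDens _ _ _).log.sub
      ((measurable_comparisonDens ρ H).comp measurable_snd).log
  have hint : Integrable (fun a => Real.log (outputDens (T * Tᴴ) σ2 H a)
      - Real.log (comparisonDens PX ρ H a.2)) (jointLaw PX T σ2 H) := by
    refine (integrable_map_measure hllrm.aestronglyMeasurable
      (measurable_jointMap T H).aemeasurable).2 (hint0.congr (.of_forall fun a => ?_))
    exact (hllr a).symm
  have hval : ∫ a, (Real.log (outputDens (T * Tᴴ) σ2 H a) - Real.log (comparisonDens PX ρ H a.2))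
      ∂(jointLaw PX T σ2 H) ≤ Nx * ∑ p, Real.log (outputCov PX ρ H p).det.re
          - Nr * ∫ x, Real.log (columnCov (T * Tᴴ) σ2 x).det.re ∂PX := by
    rw [jointLaw, integral_map (measurable_jointMap T H).aemeasurable hllrm.aestronglyMeasurable]
    simp only [hllr]
    rw [integral_neg_add_add_add (hlog.const_mul (Nr : ℝ))
      (integrable_finsetSum Finset.univ fun r _ => (hcol r).1) (integrable_const _) hrow.1, hrow.2,
      integral_const_mul, integral_finsetSum _ fun r _ => (hcol r).1,
      integral_fun_fst fun x => Real.log (columnCov (T * Tᴴ) σ2 x).det.re]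
    simp only [fun r => (hcol r).2, integral_const, probReal_univ, one_smul, Finset.sum_sub_distrib,
      Finset.sum_const, Finset.card_univ, Fintype.card_fin, nsmul_eq_mul]
    have : 0 ≤ ∑ p, (Nx * ρ - subcarrierNoise PX (T * Tᴴ) σ2 p)
        * (outputCov PX ρ H p)⁻¹.trace.re := Finset.sum_nonneg fun p _ =>
      mul_nonneg (sub_nonneg.2 (subcarrierNoise_le hX hS σ2 p))
        (trace_inv_re_nonneg (outputCov_posDef hX hρ H p))
    nlinarith [this]
  have hqm2 : Measurable fun a : Blocks Nc Nx Nt × Blocks Nc Nx Nr => comparisonDens PX ρ H a.2 :=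
    (measurable_comparisonDens ρ H).comp measurable_snd
  have hkl := klDiv_withDensity_ofReal (PX.prod volume) (measurable_outputDens (T * Tᴴ) σ2 H)
    hqm2 (outputDens_pos hσ2 H) (fun a => comparisonDens_pos hX hρ H a.2)
    (by rw [← hdens]; exact hint)
  have hle := klDiv_fst_prod_snd_le (jointLaw PX T σ2 H)
    (volume.withDensity fun y => ENNReal.ofReal (comparisonDens PX ρ H y))
  rw [fst_jointLaw, hprod] at hle
  rw [← hdens] at hkl
  exact ⟨hle.trans (hkl.1.le.trans (ENNReal.ofReal_le_ofReal hval)), hkl.2.trans hval⟩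

omit [DecidableEq κ] hX [IsProbabilityMeasure PX] in
lemma outputCov_zero (ρ : ℝ) (p : Fin Nc) :
    outputCov PX ρ (0 : Blocks Nc Nt Nr) p = (ρ : ℂ) • 1 := by
  have : (Matrix.of ((0 : Blocks Nc Nt Nr) p))ᵀ = 0 := rfl
  rw [outputCov, this, Matrix.zero_mul, Matrix.zero_mul, zero_add]

omit [IsProbabilityMeasure PX] in
/-- The averaged second moments of Gaussian signals; for `Nx = 0` the average is the junk value
`0`. -/
lemma avgMoment_pi_cscgVector {Sg : Fin Nc → Matrix (Fin Nt) (Fin Nt) ℂ}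
    (hPX : PX = Measure.pi fun p => Measure.pi fun _ : Fin Nx => cscgVector (Sg p))
    (hSg : ∀ p, (Sg p).PosSemidef) (hNx : Nx ≠ 0) (p : Fin Nc) : avgMoment PX p = Sg p := by
  have hrow : ∀ n, rowMoment PX p n = Sg p := by
    intro n
    ext t t'
    have hm : AEStronglyMeasurable (fun u : Fin Nt → ℂ => u t * star (u t')) (cscgVector (Sg p)) :=
      Continuous.aestronglyMeasurable (by fun_prop)
    have hm2 : AEStronglyMeasurable (fun u : Fin Nx → Fin Nt → ℂ => u n t * star (u n t'))
        (Measure.pi fun _ : Fin Nx => cscgVector (Sg p)) :=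
      Continuous.aestronglyMeasurable (by fun_prop)
    rw [rowMoment, Matrix.of_apply, hPX, integral_comp_eval
      (μ := fun p => Measure.pi fun _ : Fin Nx => cscgVector (Sg p)) (i := p) hm2,
      integral_comp_eval (μ := fun _ : Fin Nx => cscgVector (Sg p)) (i := n) hm]
    exact (hasCov_cscgVector (hSg p)).integral_mul_star t t'
  have h := sum_rowMoment hX p
  simp only [hrow, Finset.sum_const, Finset.card_univ, Fintype.card_fin] at h
  rw [← Nat.cast_smul_eq_nsmul ℂ] at h
  exact (smul_right_injective _ (Nat.cast_ne_zero.2 hNx) h).symm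

omit [IsProbabilityMeasure PX] in
/-- For Gaussian signalling, the comparison law is the law of the output of the channel
`y = X H + noise` with white Gaussian noise of variance `ρ`. -/
lemma lintegral_comparisonDens_sub {Sg : Fin Nc → Matrix (Fin Nt) (Fin Nt) ℂ}
    (hPX : PX = Measure.pi fun p => Measure.pi fun _ : Fin Nx => cscgVector (Sg p))
    (hSg : ∀ p, (Sg p).PosSemidef) (hNx : Nx ≠ 0) {ρ : ℝ} (hρ : 0 < ρ) (H : Blocks Nc Nt Nr)
    (y : Blocks Nc Nx Nr) :
    ∫⁻ x, ENNReal.ofReal (comparisonDens PX ρ (0 : Blocks Nc Nt Nr) (y - usefulSignal x H)) ∂PX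
      = ENNReal.ofReal (comparisonDens PX ρ H y) := by
  have hK := posDef_smul_one (ι := Fin Nr) hρ
  have hcd : ∀ x : Blocks Nc Nx Nt,
      comparisonDens PX ρ (0 : Blocks Nc Nt Nr) (y - usefulSignal x H)
        = ∏ p, ∏ n, gaussDens ((ρ : ℂ) • 1) (y p n - (Matrix.of (H p))ᵀ *ᵥ x p n) := by
    intro x
    refine Finset.prod_congr rfl fun p _ => Finset.prod_congr rfl fun n _ => ?_
    rw [outputCov_zero]
    congr 1
    ext r
    simp [usefulSignal, Matrix.mulVec, dotProduct, mul_comm]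
  have hint : ∀ p n, Integrable (fun u : Fin Nt → ℂ =>
      gaussDens ((ρ : ℂ) • 1) (y p n - (Matrix.of (H p))ᵀ *ᵥ u)) (cscgVector (Sg p)) :=
    fun p n => integrable_gaussDens_comp hK (by unfold Matrix.mulVec dotProduct; fun_prop)
  have hint2 : ∀ p, Integrable (fun u : Fin Nx → Fin Nt → ℂ =>
      ∏ n, gaussDens ((ρ : ℂ) • 1) (y p n - (Matrix.of (H p))ᵀ *ᵥ u n))
      (Measure.pi fun _ : Fin Nx => cscgVector (Sg p)) :=
    fun p => Integrable.fintype_prod_dep (hint p)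
  simp_rw [hcd]
  rw [← ofReal_integral_eq_lintegral_ofReal (by rw [hPX]; exact Integrable.fintype_prod_dep hint2)
    (.of_forall fun x => Finset.prod_nonneg fun p _ => Finset.prod_nonneg fun n _ =>
      (gaussDens_pos hK _).le)]
  congr 1
  have h1 := integral_fintype_prod_eq_prod
    (μ := fun p => Measure.pi fun _ : Fin Nx => cscgVector (Sg p))
    (f := fun p (u : Fin Nx → Fin Nt → ℂ) =>
      ∏ n, gaussDens ((ρ : ℂ) • 1) (y p n - (Matrix.of (H p))ᵀ *ᵥ u n))
  rw [← hPX] at h1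
  rw [h1, comparisonDens]
  refine Finset.prod_congr rfl fun p _ => ?_
  rw [integral_fintype_prod_eq_prod (μ := fun _ : Fin Nx => cscgVector (Sg p))
    (f := fun n (u : Fin Nt → ℂ) =>
      gaussDens ((ρ : ℂ) • 1) (y p n - (Matrix.of (H p))ᵀ *ᵥ u))]
  refine Finset.prod_congr rfl fun n _ => ?_
  rw [integral_gaussDens_sub_mulVec_cscgVector (hSg p) hρ, outputCov,
    avgMoment_pi_cscgVector hX hPX hSg hNx]

/-- The lower bound for a fixed channel and Gaussian signalling: the Donsker-Varadhan bound with the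
log-likelihood ratio of the channel in which interference plus noise is replaced by white Gaussian
noise of the variance `totalNoise`. -/
lemma le_klDiv_jointLaw {Sg : Fin Nc → Matrix (Fin Nt) (Fin Nt) ℂ}
    (hPX : PX = Measure.pi fun p => Measure.pi fun _ : Fin Nx => cscgVector (Sg p))
    (hSg : ∀ p, (Sg p).PosSemidef) (hNx : Nx ≠ 0) (hσ2 : 0 < σ2) (H : Blocks Nc Nt Nr) :
    ENNReal.ofReal (Nx * ∑ p, (Real.log (outputCov PX (totalNoise PX (T * Tᴴ) σ2) H p).det.re
        - Nr * Real.log (totalNoise PX (T * Tᴴ) σ2)))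
      ≤ klDiv (jointLaw PX T σ2 H) (PX.prod (jointLaw PX T σ2 H).snd) := by
  have hs : (0 : ℝ) < σ2 := NNReal.coe_pos.2 hσ2
  have hS := Matrix.posSemidef_self_mul_conjTranspose T
  set ρ := totalNoise PX (T * Tᴴ) σ2 with hρdef
  have hρ : 0 < ρ := totalNoise_pos hX hS hs
  have hdet0 : ∀ p, Real.log (outputCov PX ρ (0 : Blocks Nc Nt Nr) p).det.re = Nr * Real.log ρ := by
    intro p
    rw [outputCov_zero, Matrix.det_smul, Matrix.det_one, mul_one, ← Complex.ofReal_pow,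
      Complex.ofReal_re, Real.log_pow, Fintype.card_fin]
  have hrow := integral_quadForm_channelOutput (T := T) (σ2 := σ2) hX hρ H
  have hrow0 := integral_quadForm_channelOutput (T := T) (σ2 := σ2) hX hρ (0 : Blocks Nc Nt Nr)
  set f : Blocks Nc Nx Nt × Blocks Nc Nx Nr → ℝ := fun a =>
    Real.log (comparisonDens PX ρ (0 : Blocks Nc Nt Nr) (a.2 - usefulSignal a.1 H))
      - Real.log (comparisonDens PX ρ H a.2) with hf
  have hsub : Measurable fun a : Blocks Nc Nx Nt × Blocks Nc Nx Nr =>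
      a.2 - usefulSignal a.1 H := by
    unfold usefulSignal
    fun_prop
  have hfm : Measurable f := ((measurable_comparisonDens ρ _).comp hsub).log.sub
    ((measurable_comparisonDens ρ H).comp measurable_snd).log
  have hfa : ∀ a : Blocks Nc Nx Nt × (Fin Nr → κ → ℂ) × Blocks Nc Nx Nr,
      f (a.1, channelOutput T H a.1 a.2.1 a.2.2)
        = (Nx * ∑ p, (Real.log (outputCov PX ρ H p).det.re - Nr * Real.log ρ)
          - ∑ p, ∑ n, quadForm (outputCov PX ρ (0 : Blocks Nc Nt Nr) p)⁻¹
            (channelOutput T 0 a.1 a.2.1 a.2.2 p n))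
          + ∑ p, ∑ n, quadForm (outputCov PX ρ H p)⁻¹
            (channelOutput T H a.1 a.2.1 a.2.2 p n) := by
    intro a
    have h0 : channelOutput T H a.1 a.2.1 a.2.2 - usefulSignal a.1 H
        = channelOutput T 0 a.1 a.2.1 a.2.2 := by
      ext p n r
      simp [channelOutput, usefulSignal]
    simp only [hf, h0]
    rw [log_comparisonDens hX hρ, log_comparisonDens hX hρ]
    simp only [hdet0, Finset.sum_sub_distrib]
    ring
  have hint0 := ((integrable_const (Nx * ∑ p, (Real.log (outputCov PX ρ H p).det.re
    - Nr * Real.log ρ))).sub hrow0.1).add hrow.1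
  have hint : Integrable f (jointLaw PX T σ2 H) :=
    (integrable_map_measure hfm.aestronglyMeasurable (measurable_jointMap T H).aemeasurable).2
      (hint0.congr (.of_forall fun a => (hfa a).symm))
  have hval : Nx * ∑ p, (Real.log (outputCov PX ρ H p).det.re - Nr * Real.log ρ)
      ≤ ∫ a, f a ∂(jointLaw PX T σ2 H) := by
    rw [jointLaw, integral_map (measurable_jointMap T H).aemeasurable hfm.aestronglyMeasurable]
    simp only [hfa]
    rw [integral_sub_add (integrable_const _) hrow0.1 hrow.1, hrow.2, hrow0.2]
    simp only [integral_const, probReal_univ, one_smul]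
    rw [sub_add, le_sub_self_iff, ← Finset.sum_sub_distrib]
    refine Finset.sum_nonpos fun p _ => ?_
    have h1 := subcarrierNoise_le hX hS σ2 p
    have h2 := trace_inv_add_smul_one_le
      ((avgMoment_posSemidef hX p).mul_mul_conjTranspose_same (Matrix.of (H p))ᵀ) hρ
    rw [← outputCov, Fintype.card_fin] at h2
    -- `outputCov` for the zero channel is `ρ`, so that the trace of its inverse is `Nr / ρ`.
    have h3 := trace_inv_add_smul_one (Matrix.PosSemidef.zero : (0 : Matrix (Fin Nr) (Fin Nr)
      ℂ).PosSemidef) hρ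
    rw [zero_add, Matrix.mul_zero, Matrix.trace_zero, Complex.zero_re, Fintype.card_fin] at h3
    rw [outputCov_zero]
    have h4 : (outputCov PX ρ H p)⁻¹.trace.re ≤ ((ρ : ℂ) • (1 : Matrix (Fin Nr) (Fin Nr)
        ℂ))⁻¹.trace.re := le_of_mul_le_mul_left (by linarith) hρ
    have h5 := mul_le_mul_of_nonneg_left h4 (sub_nonneg.2 h1)
    linarith
  have hexp : ∫ a, Real.exp (f a) ∂(PX.prod (jointLaw PX T σ2 H).snd) = 1 := by
    have hexpf : ∀ a : Blocks Nc Nx Nt × Blocks Nc Nx Nr, Real.exp (f a)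
        = (comparisonDens PX ρ H a.2)⁻¹
          * comparisonDens PX ρ (0 : Blocks Nc Nt Nr) (a.2 - usefulSignal a.1 H) := by
      intro a
      simp only [hf]
      rw [Real.exp_sub, Real.exp_log (comparisonDens_pos hX hρ _ _),
        Real.exp_log (comparisonDens_pos hX hρ _ _), div_eq_inv_mul]
    rw [integral_eq_lintegral_of_nonneg_ae (.of_forall fun a => (Real.exp_pos _).le)
      hfm.exp.aestronglyMeasurable, lintegral_prod_symm _ hfm.exp.ennreal_ofReal.aemeasurable]
    have hin : ∀ y : Blocks Nc Nx Nr, ∫⁻ x, ENNReal.ofReal (Real.exp (f (x, y))) ∂PX = 1 := by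
      intro y
      have hpos := comparisonDens_pos hX hρ H y
      have hsub' : Measurable fun x : Blocks Nc Nx Nt => y - usefulSignal x H := by
        unfold usefulSignal
        fun_prop
      have hm : Measurable fun x : Blocks Nc Nx Nt =>
          comparisonDens PX ρ (0 : Blocks Nc Nt Nr) (y - usefulSignal x H) :=
        (measurable_comparisonDens ρ (0 : Blocks Nc Nt Nr)).comp hsub'
      simp_rw [hexpf, ENNReal.ofReal_mul (inv_nonneg.2 hpos.le)]
      rw [lintegral_const_mul _ hm.ennreal_ofReal,
        lintegral_comparisonDens_sub hX hPX hSg hNx hρ H y, ← ENNReal.ofReal_mul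
        (inv_nonneg.2 hpos.le), inv_mul_cancel₀ hpos.ne', ENNReal.ofReal_one]
    simp [hin]
  exact (ENNReal.ofReal_le_ofReal hval).trans (ofReal_integral_le_klDiv _ _ hint hexp)

end FixedChannelBounds

end UplinkISAC

namespace UplinkISAC

/-! ### Block diagonal matrices and the rate `lowRate` -/

section Rate

variable {Nc Nx Nt Nr : ℕ}

lemma blkDiag_mul {m n k : ℕ} (A : Blocks Nc m n) (B : Blocks Nc n k) :
    blkDiag A * blkDiag B
      = blkDiag fun p i j => (Matrix.of (A p) * Matrix.of (B p)) i j := by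
  have h := Matrix.submatrix_mul_equiv (Matrix.blockDiagonal fun p => Matrix.of (A p))
    (Matrix.blockDiagonal fun p => Matrix.of (B p)) (Prod.swap : Fin Nc × Fin m → _)
    (Equiv.prodComm (Fin Nc) (Fin n)) (Prod.swap : Fin Nc × Fin k → _)
  rw [← Matrix.blockDiagonal_mul] at h
  exact h

lemma conjTranspose_blkDiag {m n : ℕ} (A : Blocks Nc m n) :
    (blkDiag A)ᴴ = blkDiag fun p i j => star (A p j i) := by
  rw [blkDiag, Matrix.conjTranspose_submatrix, Matrix.blockDiagonal_conjTranspose]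
  rfl

lemma det_blkDiag {m : ℕ} (A : Blocks Nc m m) :
    (blkDiag A).det = ∏ p, (Matrix.of (A p)).det := by
  rw [← Matrix.det_blockDiagonal]
  exact Matrix.det_submatrix_equiv_self (Equiv.prodComm _ _) _

lemma one_kronecker_smul_one (c : ℂ) :
    (1 : Matrix (Fin Nc) (Fin Nc) ℂ) ⊗ₖ (c • (1 : Matrix (Fin Nr) (Fin Nr) ℂ)) = c • 1 := by
  rw [Matrix.kronecker_smul, Matrix.one_kronecker_one]

lemma inv_smul_one {c : ℂ} (hc : c ≠ 0) :
    (c • (1 : Matrix (Fin Nr) (Fin Nr) ℂ))⁻¹ = c⁻¹ • 1 := by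
  refine Matrix.inv_eq_right_inv ?_
  rw [Matrix.smul_mul, Matrix.one_mul, smul_smul, mul_inv_cancel₀ hc, one_smul]

variable {PX : Measure (Blocks Nc Nx Nt)} (hX : ∀ p n t, MemLp (fun x => x p n t) 2 PX)
include hX

lemma sigmaX_eq_blkDiag :
    sigmaX PX (fun x => x) = blkDiag fun p t t' => avgMoment PX p t' t := by
  ext ⟨p, t⟩ ⟨q, t'⟩
  refine Eq.trans ?_ (blkDiag_apply _ _ _).symm
  split_ifs with h
  · obtain rfl : p = q := h
    rfl
  · rw [sigmaX, Matrix.smul_apply, txGram_block hX, if_neg (Ne.symm h), smul_zero]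

/-- Up to the factor `ρ⁻¹`, the matrix in `lowRate` is block diagonal, with the transposes of the
matrices `outputCov` as its blocks. -/
lemma lowRate_eq {ρ : ℝ} (hρ : 0 < ρ) (H : Blocks Nc Nt Nr) :
    lowRate Nx H (sigmaX PX fun x => x) ((ρ : ℂ) • 1)
      = Nx * ∑ p, (Real.log (outputCov PX ρ H p).det.re - Nr * Real.log ρ) / Real.log 2 := by
  have hρc : (ρ : ℂ) ≠ 0 := by exact_mod_cast hρ.ne'
  have hB := outputCov_posDef hX hρ H
  have h1 : (1 : Matrix (Fin Nc × Fin Nr) (Fin Nc × Fin Nr) ℂ)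
      = blkDiag fun _ i j => (1 : Matrix (Fin Nr) (Fin Nr) ℂ) i j := by
    ext a b
    refine Eq.trans ?_ (blkDiag_apply _ _ _).symm
    simp only [Matrix.one_apply, Prod.ext_iff]
    split_ifs <;> simp_all
  have hmat : 1 + (blkDiag H)ᴴ * (sigmaX PX fun x => x) * blkDiag H
        * ((1 : Matrix (Fin Nc) (Fin Nc) ℂ) ⊗ₖ ((ρ : ℂ) • (1 : Matrix (Fin Nr) (Fin Nr) ℂ))⁻¹)
      = (ρ : ℂ)⁻¹ • blkDiag fun p i j => outputCov PX ρ H p j i := by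
    rw [inv_smul_one hρc, one_kronecker_smul_one, Matrix.mul_smul, Matrix.mul_one,
      sigmaX_eq_blkDiag hX, conjTranspose_blkDiag, blkDiag_mul, blkDiag_mul,
      ← inv_smul_smul₀ hρc (1 : Matrix (Fin Nc × Fin Nr) (Fin Nc × Fin Nr) ℂ), ← smul_add]
    congr 1
    rw [h1]
    ext a b
    refine (congrArg₂ (· + ·) (congrArg ((ρ : ℂ) • ·) (blkDiag_apply _ _ _))
      (blkDiag_apply _ _ _)).trans (Eq.trans ?_ (blkDiag_apply _ _ _).symm)
    split_ifs with h
    · have htr : (outputCov PX ρ H a.1)ᵀ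
          = (Matrix.of (H a.1))ᴴ * (avgMoment PX a.1)ᵀ * Matrix.of (H a.1) + (ρ : ℂ) • 1 := by
        rw [outputCov, Matrix.transpose_add, Matrix.transpose_mul, Matrix.transpose_mul,
          Matrix.transpose_transpose, Matrix.transpose_smul, Matrix.transpose_one,
          ← Matrix.mul_assoc]
        rfl
      have h2 := congrFun (congrFun htr a.2) b.2
      rw [add_comm] at h2
      exact h2.symm
    · simp
  have hdet : (1 + (blkDiag H)ᴴ * (sigmaX PX fun x => x) * blkDiag H
        * ((1 : Matrix (Fin Nc) (Fin Nc) ℂ) ⊗ₖ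
          ((ρ : ℂ) • (1 : Matrix (Fin Nr) (Fin Nr) ℂ))⁻¹)).det.re
      = ρ⁻¹ ^ (Nc * Nr) * ∏ p, (outputCov PX ρ H p).det.re := by
    have h2 : ∀ p, (Matrix.of fun i j => outputCov PX ρ H p j i).det
        = (((outputCov PX ρ H p).det.re : ℝ) : ℂ) := fun p => by
      rw [(hB p).coe_det_re]
      exact Matrix.det_transpose _
    rw [hmat, Matrix.det_smul, det_blkDiag, Fintype.card_prod, Fintype.card_fin, Fintype.card_fin]
    simp_rw [h2]
    rw [← Complex.ofReal_inv, ← Complex.ofReal_pow, ← Complex.ofReal_prod, ← Complex.ofReal_mul,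
      Complex.ofReal_re]
  rw [lowRate, hdet, Real.logb, Real.log_mul (by positivity)
    (Finset.prod_pos fun p _ => (hB p).det_re_pos).ne', Real.log_pow, Real.log_inv,
    Real.log_prod fun p _ => (hB p).det_re_pos.ne', ← Finset.sum_div, Finset.sum_sub_distrib]
  simp only [Finset.sum_const, Finset.card_univ, Fintype.card_fin, nsmul_eq_mul, Nat.cast_mul]
  ring

lemma lowRate_nonneg {ρ : ℝ} (hρ : 0 < ρ) (H : Blocks Nc Nt Nr) :
    0 ≤ lowRate Nx H (sigmaX PX fun x => x) ((ρ : ℂ) • 1) := by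
  rw [lowRate_eq hX hρ]
  refine mul_nonneg (Nat.cast_nonneg _) (Finset.sum_nonneg fun p _ => div_nonneg ?_
    (Real.log_nonneg one_le_two))
  have h := Real.log_le_log (by positivity) (pow_card_le_det_re
    ((avgMoment_posSemidef hX p).mul_mul_conjTranspose_same (Matrix.of (H p))ᵀ) hρ)
  rw [Real.log_pow, Fintype.card_fin, ← outputCov] at h
  linarith

lemma coe_totalNoise {S : Matrix (Fin Nc × Fin Nt) (Fin Nc × Fin Nt) ℂ} (hS : S.PosSemidef)
    (s : ℝ) :
    ((totalNoise PX S s : ℝ) : ℂ) = (txGram PX (fun x => x) * S).trace / (Nx : ℂ) + (s : ℂ) := by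
  have h : ((txGram PX (fun x => x) * S).trace.re : ℂ) = (txGram PX (fun x => x) * S).trace := by
    rw [← sum_integral_diag hX, Complex.re_sum, Complex.ofReal_sum]
    refine Finset.sum_congr rfl fun a _ => ?_
    have h1 : ∀ x : Blocks Nc Nx Nt, (blkDiag x * S * (blkDiag x)ᴴ) a a
        = (((blkDiag x * S * (blkDiag x)ᴴ) a a).re : ℂ) := fun x =>
      Complex.ext rfl (by
        simpa using (Complex.nonneg_iff.1
          (hS.mul_mul_conjTranspose_same (blkDiag x)).diag_nonneg).2.symm)
    rw [integral_congr_ae (.of_forall h1), integral_complex_ofReal, Complex.ofReal_re]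
  rw [totalNoise, Complex.ofReal_add, Complex.ofReal_div, h, Complex.ofReal_natCast]

omit hX in
lemma measurable_lowRate (SX : Matrix (Fin Nc × Fin Nt) (Fin Nc × Fin Nt) ℂ)
    (R : Matrix (Fin Nr) (Fin Nr) ℂ) : Measurable fun H : Blocks Nc Nt Nr => lowRate Nx H SX R := by
  have hb := continuous_blkDiag (Nc := Nc) (m := Nt) (n := Nr)
  have hc : Continuous fun H : Blocks Nc Nt Nr => (1 + (blkDiag H)ᴴ * SX * blkDiag H
      * ((1 : Matrix (Fin Nc) (Fin Nc) ℂ) ⊗ₖ R⁻¹)).det.re := by fun_prop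
  unfold lowRate Real.logb
  exact ((Real.measurable_log.comp hc.measurable).div_const _).const_mul _

end Rate

/-! ### Reduction of the model to a fixed communication channel -/

section Model

variable {Nc Nx Nt Nr Lc Ls : ℕ}

/-- The matrices `G_{ω,l}` with the variances `τ2 l`, built from standard vectors `z r`, one for
each receive antenna. -/
def tapScaling (τ2 : Fin (Ls + 1) → ℝ≥0) (z : Fin Nr → Fin (Ls + 1) × Fin Nt → ℂ) :
    Fin (Ls + 1) → Fin Nt → Fin Nr → ℂ :=
  fun l t r => ((√(τ2 l : ℝ) : ℝ) : ℂ) * z r (l, t)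

/-- The matrix that maps a standard vector to a column of the stacked matrix `G`. -/
def sensingMatrix (Nc : ℕ) (τ2 : Fin (Ls + 1) → ℝ≥0)
    (Rs : Fin (Ls + 1) → Matrix (Fin Nt) (Fin Nt) ℂ) :
    Matrix (Fin Nc × Fin Nt) (Fin (Ls + 1) × Fin Nt) ℂ :=
  Matrix.of fun a k => CFC.sqrt (Rs k.1) a.2 k.2 * ((√(τ2 k.1 : ℝ) : ℝ) : ℂ)
    * Complex.exp (-Complex.I * (2 * Real.pi / (Nc : ℂ)) * ((k.1 : ℕ) : ℂ) * ((a.1 : ℕ) : ℂ))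

lemma measurable_tapScaling (τ2 : Fin (Ls + 1) → ℝ≥0) :
    Measurable (tapScaling τ2 : (Fin Nr → Fin (Ls + 1) × Fin Nt → ℂ) → _) := by
  unfold tapScaling
  fun_prop

lemma map_tapScaling (τ2 : Fin (Ls + 1) → ℝ≥0) :
    (interferenceLaw Nr (Fin (Ls + 1) × Fin Nt)).map (tapScaling τ2)
      = Measure.pi fun l => Measure.pi fun _ : Fin Nt => Measure.pi fun _ : Fin Nr =>
        cscg (τ2 l) := by
  have h1 : ∀ l, (Measure.pi fun _ : Fin Nr => cscg (τ2 l))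
      = (Measure.pi fun _ : Fin Nr => cscg 1).map
        fun x r => ((√(τ2 l : ℝ) : ℝ) : ℂ) * x r := fun l => by
    have : SigmaFinite ((cscg 1).map fun z => ((√(τ2 l : ℝ) : ℝ) : ℂ) * z) := by
      rw [← cscg_eq_map_cscg_one]; infer_instance
    rw [Measure.pi_map_pi (f := fun _ z => ((√(τ2 l : ℝ) : ℝ) : ℂ) * z) (by fun_prop),
      ← cscg_eq_map_cscg_one]
  have h2 : ∀ l, (Measure.pi fun _ : Fin Nt => Measure.pi fun _ : Fin Nr => cscg (τ2 l))
      = (Measure.pi fun _ : Fin Nt => Measure.pi fun _ : Fin Nr => cscg 1).map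
        fun x t r => ((√(τ2 l : ℝ) : ℝ) : ℂ) * x t r := fun l => by
    have : SigmaFinite ((Measure.pi fun _ : Fin Nr => cscg 1).map
        fun x r => ((√(τ2 l : ℝ) : ℝ) : ℂ) * x r) := by rw [← h1]; infer_instance
    rw [Measure.pi_map_pi (f := fun (_ : Fin Nt) (x : Fin Nr → ℂ) r =>
      ((√(τ2 l : ℝ) : ℝ) : ℂ) * x r)
      fun _ => Measurable.aemeasurable (by fun_prop), ← h1]
  have h3 : (Measure.pi fun l => Measure.pi fun _ : Fin Nt => Measure.pi fun _ : Fin Nr =>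
        cscg (τ2 l))
      = (Measure.pi fun _ : Fin (Ls + 1) => Measure.pi fun _ : Fin Nt =>
        Measure.pi fun _ : Fin Nr => cscg 1).map
        fun x l t r => ((√(τ2 l : ℝ) : ℝ) : ℂ) * x l t r := by
    have : ∀ l, SigmaFinite ((Measure.pi fun _ : Fin Nt => Measure.pi fun _ : Fin Nr =>
        cscg 1).map fun x t r => ((√(τ2 l : ℝ) : ℝ) : ℂ) * x t r) := fun l => by
      rw [← h2]; infer_instance
    rw [Measure.pi_map_pi (f := fun l (x : Fin Nt → Fin Nr → ℂ) t r =>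
      ((√(τ2 l : ℝ) : ℝ) : ℂ) * x t r)
      fun _ => Measurable.aemeasurable (by fun_prop)]
    simp_rw [← h2]
  have hswap := measurePreserving_swap_pi (ι := Fin (Ls + 1) × Fin Nt) (κ := Fin Nr)
    fun _ _ => cscg 1
  have hcurry := measurePreserving_curry (ι := Fin (Ls + 1)) (κ := Fin Nt)
    fun _ _ => Measure.pi fun _ : Fin Nr => cscg 1
  rw [h3, ← (hcurry.comp hswap).map_eq, Measure.map_map (by fun_prop)
    (hcurry.comp hswap).measurable]
  rfl

lemma freqResponse_tapScaling (τ2 : Fin (Ls + 1) → ℝ≥0)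
    (Rs : Fin (Ls + 1) → Matrix (Fin Nt) (Fin Nt) ℂ) (z : Fin Nr → Fin (Ls + 1) × Fin Nt → ℂ)
    (p : Fin Nc) (t : Fin Nt) (r : Fin Nr) :
    freqResponse Nc (correlatedTaps Rs (tapScaling τ2 z)) p t r
      = (sensingMatrix Nc τ2 Rs *ᵥ z r) (p, t) := by
  simp only [freqResponse, correlatedTaps, sensingMatrix, Matrix.mulVec, dotProduct,
    Matrix.mul_apply, Matrix.of_apply, Fintype.sum_prod_type, tapScaling, Finset.sum_mul]
  exact Finset.sum_congr rfl fun l _ => Finset.sum_congr rfl fun t' _ => by ring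

lemma received_tapScaling (τ2 : Fin (Ls + 1) → ℝ≥0)
    (Rs : Fin (Ls + 1) → Matrix (Fin Nt) (Fin Nt) ℂ) (H : Blocks Nc Nt Nr) (x : Blocks Nc Nx Nt)
    (z : Fin Nr → Fin (Ls + 1) × Fin Nt → ℂ) (w : Blocks Nc Nx Nr) :
    received x H (freqResponse Nc (correlatedTaps Rs (tapScaling τ2 z))) w
      = channelOutput (sensingMatrix Nc τ2 Rs) H x z w := by
  have h : ∀ p n r, (blkDiag x *ᵥ (sensingMatrix Nc τ2 Rs *ᵥ z r)) (p, n)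
      = ∑ t, x p n t * (sensingMatrix Nc τ2 Rs *ᵥ z r) (p, t) := by
    intro p n r
    rw [Matrix.mulVec, dotProduct, Fintype.sum_prod_type,
      Finset.sum_eq_single p (fun q _ hq => by simp [blkDiag_apply, Ne.symm hq]) (by simp)]
    simp [blkDiag_apply]
  ext p n r
  simp only [channelOutput, ← Matrix.mulVec_mulVec, h, ← freqResponse_tapScaling]
  simp only [received, usefulSignal, Matrix.add_apply, Matrix.mul_apply, Matrix.of_apply,
    add_assoc]

lemma measurable_freqResponse {L m n : ℕ} :
    Measurable (freqResponse (L := L) (m := m) (n := n) Nc) := by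
  unfold freqResponse
  fun_prop

lemma measurable_correlatedTaps (Rs : Fin (Ls + 1) → Matrix (Fin Nt) (Fin Nt) ℂ) :
    Measurable (correlatedTaps (Nr := Nr) Rs) := by
  refine measurable_pi_lambda _ fun l => measurable_pi_lambda _ fun t =>
    measurable_pi_lambda _ fun r => ?_
  simp only [correlatedTaps, Matrix.mul_apply, Matrix.of_apply]
  fun_prop

lemma measurable_received {α : Type*} [MeasurableSpace α] {x : α → Blocks Nc Nx Nt}
    {H G : α → Blocks Nc Nt Nr} {w : α → Blocks Nc Nx Nr} (hx : Measurable x) (hH : Measurable H)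
    (hG : Measurable G) (hw : Measurable w) :
    Measurable fun a => received (x a) (H a) (G a) (w a) := by
  refine measurable_pi_lambda _ fun p => measurable_pi_lambda _ fun n =>
    measurable_pi_lambda _ fun r => ?_
  simp only [received, Matrix.add_apply, Matrix.mul_apply, Matrix.of_apply]
  fun_prop

variable {Ω : Type*} [MeasurableSpace Ω] {μ : Measure Ω} [IsProbabilityMeasure μ]
  {X : Ω → Blocks Nc Nx Nt} {h : Ω → Fin (Lc + 1) → Fin Nt → Fin Nr → ℂ}
  {Gw : Ω → Fin (Ls + 1) → Fin Nt → Fin Nr → ℂ} {W : Ω → Blocks Nc Nx Nr}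
  {τ2 : Fin (Ls + 1) → ℝ≥0} {σ2 : ℝ≥0}

lemma IsModel.map_signals (hm : IsModel μ X h Gw W τ2 σ2) :
    μ.map (fun ω => (X ω, Gw ω, W ω))
      = ((μ.map X).prod ((interferenceLaw Nr (Fin (Ls + 1) × Fin Nt)).prod
        (noiseLaw Nc Nx Nr σ2))).map fun a => (a.1, tapScaling τ2 a.2.1, a.2.2) := by
  have hX : AEMeasurable X μ := hm.measurable_X.aemeasurable
  have hG := hm.law_Gw.aemeasurable
  have hW := hm.law_W.aemeasurable
  have : IsProbabilityMeasure (μ.map X) := Measure.isProbabilityMeasure_map hX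
  rw [(indepFun_iff_map_prod_eq_prod_map_map hX (hG.prodMk hW)).1 hm.indep_X,
    (indepFun_iff_map_prod_eq_prod_map_map hG hW).1 hm.indep_Gw, hm.law_Gw.map_eq, hm.law_W.map_eq,
    ← map_tapScaling]
  have h1 := Measure.map_prod_map (interferenceLaw Nr (Fin (Ls + 1) × Fin Nt))
    (noiseLaw Nc Nx Nr σ2) (measurable_tapScaling τ2) measurable_id
  have h2 := Measure.map_prod_map (μ.map X) ((interferenceLaw Nr (Fin (Ls + 1) × Fin Nt)).prod
    (noiseLaw Nc Nx Nr σ2)) measurable_id ((measurable_tapScaling τ2).prodMap measurable_id)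
  rw [← h1, Measure.map_id, Measure.map_id] at h2
  exact h2

omit [IsProbabilityMeasure μ] in
lemma IsModel.memLp_map (hm : IsModel μ X h Gw W τ2 σ2) (p : Fin Nc) (n : Fin Nx) (t : Fin Nt) :
    MemLp (fun x : Blocks Nc Nx Nt => x p n t) 2 (μ.map X) :=
  (memLp_map_measure_iff (Measurable.aestronglyMeasurable (by fun_prop))
    hm.measurable_X.aemeasurable).2 (hm.memLp_X p n t)

omit [IsProbabilityMeasure μ] in
lemma IsModel.sigmaG_eq (hm : IsModel μ X h Gw W τ2 σ2)
    (Rs : Fin (Ls + 1) → Matrix (Fin Nt) (Fin Nt) ℂ) (ν : Fin Nr) :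
    sigmaG μ (fun ω => freqResponse Nc (correlatedTaps Rs (Gw ω))) ν
      = sensingMatrix Nc τ2 Rs * (sensingMatrix Nc τ2 Rs)ᴴ := by
  ext a b
  have hmeas : Measurable fun g : Fin (Ls + 1) → Fin Nt → Fin Nr → ℂ =>
      freqResponse Nc (correlatedTaps Rs g) :=
    measurable_freqResponse.comp (measurable_correlatedTaps Rs)
  have hF : Measurable fun g : Fin (Ls + 1) → Fin Nt → Fin Nr → ℂ =>
      freqResponse Nc (correlatedTaps Rs g) a.1 a.2 ν
        * star (freqResponse Nc (correlatedTaps Rs g) b.1 b.2 ν) := by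
    have h1 : ∀ c : Fin Nc × Fin Nt, Measurable fun g : Fin (Ls + 1) → Fin Nt → Fin Nr → ℂ =>
      freqResponse Nc (correlatedTaps Rs g) c.1 c.2 ν := fun c => by fun_prop
    exact (h1 a).mul (continuous_star.measurable.comp (h1 b))
  have hc := (hasCov_interferenceLaw (Nr := Nr) (sensingMatrix Nc τ2 Rs)).integral_mul_star
    (ν, a) (ν, b)
  rw [Matrix.of_apply, if_pos rfl] at hc
  rw [sigmaG, Matrix.of_apply, ← hc, ← integral_map (f := fun g =>
    freqResponse Nc (correlatedTaps Rs g) a.1 a.2 ν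
      * star (freqResponse Nc (correlatedTaps Rs g) b.1 b.2 ν)) hm.law_Gw.aemeasurable
    hF.aestronglyMeasurable, hm.law_Gw.map_eq, ← map_tapScaling,
    integral_map (measurable_tapScaling τ2).aemeasurable hF.aestronglyMeasurable]
  simp only [freqResponse_tapScaling]

lemma measurable_received_fixed (Rs : Fin (Ls + 1) → Matrix (Fin Nt) (Fin Nt) ℂ)
    (H : Blocks Nc Nt Nr) : Measurable fun v : Blocks Nc Nx Nt ×
      (Fin (Ls + 1) → Fin Nt → Fin Nr → ℂ) × Blocks Nc Nx Nr =>
      (v.1, received v.1 H (freqResponse Nc (correlatedTaps Rs v.2.1)) v.2.2) := by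
  have hg : Measurable fun v : Blocks Nc Nx Nt × (Fin (Ls + 1) → Fin Nt → Fin Nr → ℂ) ×
      Blocks Nc Nx Nr => freqResponse Nc (correlatedTaps Rs v.2.1) :=
    (measurable_freqResponse.comp (measurable_correlatedTaps Rs)).comp
      (measurable_fst.comp measurable_snd)
  have h2 := measurable_received (H := fun _ => H) (measurable_fst (α := Blocks Nc Nx Nt))
    measurable_const hg (measurable_snd.comp measurable_snd)
  exact measurable_fst.prodMk h2

lemma IsModel.map_received (hm : IsModel μ X h Gw W τ2 σ2)
    (Rs : Fin (Ls + 1) → Matrix (Fin Nt) (Fin Nt) ℂ) (H : Blocks Nc Nt Nr) :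
    (μ.map fun ω => (X ω, Gw ω, W ω)).map (fun v =>
      (v.1, received v.1 H (freqResponse Nc (correlatedTaps Rs v.2.1)) v.2.2))
      = jointLaw (μ.map X) (sensingMatrix Nc τ2 Rs) σ2 H := by
  have hs : Measurable fun a : Blocks Nc Nx Nt × (Fin Nr → Fin (Ls + 1) × Fin Nt → ℂ) ×
      Blocks Nc Nx Nr => (a.1, tapScaling τ2 a.2.1, a.2.2) :=
    measurable_fst.prodMk (((measurable_tapScaling τ2).comp (measurable_fst.comp
      measurable_snd)).prodMk (measurable_snd.comp measurable_snd))
  rw [hm.map_signals, Measure.map_map (measurable_received_fixed Rs H) hs, jointLaw]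
  congr 1
  funext a
  exact congrArg (Prod.mk a.1) (received_tapScaling τ2 Rs H a.1 a.2.1 a.2.2)

/-- Conditioning on `H` amounts to fixing its value, since the other signals are independent of
it. -/
lemma IsModel.condMutualInfo_eq (hm : IsModel μ X h Gw W τ2 σ2)
    (Rs : Fin (Ls + 1) → Matrix (Fin Nt) (Fin Nt) ℂ) :
    condMutualInfo μ X (fun ω => received (X ω) (freqResponse Nc (h ω))
        (freqResponse Nc (correlatedTaps Rs (Gw ω))) (W ω)) (fun ω => freqResponse Nc (h ω))
      = ∫⁻ H, klDiv (jointLaw (μ.map X) (sensingMatrix Nc τ2 Rs) σ2 H)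
          ((μ.map X).prod (jointLaw (μ.map X) (sensingMatrix Nc τ2 Rs) σ2 H).snd)
          ∂(μ.map fun ω => freqResponse Nc (h ω)) := by
  have hX := hm.measurable_X
  have : IsProbabilityMeasure (μ.map X) := Measure.isProbabilityMeasure_map hX.aemeasurable
  have hV : AEMeasurable (fun ω => (X ω, Gw ω, W ω)) μ :=
    hX.aemeasurable.prodMk (hm.law_Gw.aemeasurable.prodMk hm.law_W.aemeasurable)
  have hZ : Measurable fun ω => freqResponse Nc (h ω) :=
    measurable_freqResponse.comp hm.measurable_h
  have hind : IndepFun (fun ω => freqResponse Nc (h ω)) (fun ω => (X ω, Gw ω, W ω)) μ :=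
    hm.indep_h.comp measurable_freqResponse measurable_id
  have hF : Measurable fun a : Blocks Nc Nt Nr × Blocks Nc Nx Nt ×
      (Fin (Ls + 1) → Fin Nt → Fin Nr → ℂ) × Blocks Nc Nx Nr => a.2.1 := by fun_prop
  have hF' : Measurable fun a : Blocks Nc Nt Nr × Blocks Nc Nx Nt ×
      (Fin (Ls + 1) → Fin Nt → Fin Nr → ℂ) × Blocks Nc Nx Nr =>
      received a.2.1 a.1 (freqResponse Nc (correlatedTaps Rs a.2.2.1)) a.2.2.2 :=
    measurable_received hF measurable_fst ((measurable_freqResponse.comp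
      (measurable_correlatedTaps Rs)).comp (measurable_fst.comp (measurable_snd.comp
      measurable_snd))) (measurable_snd.comp (measurable_snd.comp measurable_snd))
  have hcond := condMutualInfo_of_indepFun hZ.aemeasurable hV hind hF hF'
  refine hcond.trans (lintegral_congr fun H => ?_)
  have hH := measurable_received_fixed (Nc := Nc) (Nx := Nx) Rs H
  have hjoint := hm.map_received Rs H
  have hfst : (μ.map fun ω => (X ω, Gw ω, W ω)).map (fun v => v.1) = μ.map X := by
    rw [AEMeasurable.map_map_of_aemeasurable measurable_fst.aemeasurable hV]
    rfl
  have hsnd : (μ.map fun ω => (X ω, Gw ω, W ω)).map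
      (fun v => received v.1 H (freqResponse Nc (correlatedTaps Rs v.2.1)) v.2.2)
      = (jointLaw (μ.map X) (sensingMatrix Nc τ2 Rs) σ2 H).snd := by
    rw [← hjoint, Measure.snd, Measure.map_map measurable_snd hH]
    rfl
  simp only
  rw [hjoint, hfst, hsnd]

end Model

end UplinkISAC

end

theorem theorem1 {Ω : Type*} [MeasurableSpace Ω] (μ : Measure Ω) [IsProbabilityMeasure μ]
    {Nc Nx Nt Nr Lc Ls : ℕ}
    (X : Ω → Fin Nc → Fin Nx → Fin Nt → ℂ)
    (h : Ω → Fin (Lc + 1) → Fin Nt → Fin Nr → ℂ)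
    (Gw : Ω → Fin (Ls + 1) → Fin Nt → Fin Nr → ℂ)
    (W : Ω → Fin Nc → Fin Nx → Fin Nr → ℂ)
    (τ2 : Fin (Ls + 1) → ℝ≥0) (σ2 : ℝ≥0) (hσ2 : 0 < σ2)
    (Rs : Fin (Ls + 1) → Matrix (Fin Nt) (Fin Nt) ℂ) (hRs : ∀ l, (Rs l).PosSemidef)
    (hmodel : IsModel μ X h Gw W τ2 σ2)
    (H G : Ω → Fin Nc → Fin Nt → Fin Nr → ℂ) (Y : Ω → Fin Nc → Fin Nx → Fin Nr → ℂ)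
    (hH : H = fun ω => freqResponse Nc (h ω))
    (hG : G = fun ω => freqResponse Nc (correlatedTaps Rs (Gw ω)))
    (hY : Y = fun ω => received (X ω) (H ω) (G ω) (W ω))
    (ν : Fin Nr)
    (SX SG : Matrix (Fin Nc × Fin Nt) (Fin Nc × Fin Nt) ℂ) (R : Matrix (Fin Nr) (Fin Nr) ℂ)
    (hSX : SX = sigmaX μ X) (hSG : SG = sigmaG μ G ν) (hR : R = interferenceCov Nr μ X SG σ2)
    (Ilow : ℝ≥0∞) (hIlow : Ilow = ∫⁻ ω, ENNReal.ofReal (lowRate Nx (H ω) SX R) ∂μ) :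
    (IsGaussianSignal μ X → Ilow ≤ condMutualInfoBits μ X Y H) ∧
    Integrable (fun ω => condLogDet (X ω) SG σ2) μ ∧
    ((condMutualInfoBits μ X Y H : ℝ≥0∞) : EReal) ≤ (Ilow : EReal) +
      (((Nx : ℝ) * Real.logb 2 ((1 : Matrix (Fin Nc) (Fin Nc) ℂ) ⊗ₖ R).det.re
        - (Nr : ℝ) * ∫ ω, condLogDet (X ω) SG σ2 ∂μ : ℝ) : EReal) := by
  have hX := hmodel.measurable_X
  have hXp := hmodel.memLp_map
  have hPX : IsProbabilityMeasure (μ.map X) := Measure.isProbabilityMeasure_map hX.aemeasurable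
  have hHm : Measurable H := by
    rw [hH]
    exact measurable_freqResponse.comp hmodel.measurable_h
  set T := sensingMatrix Nc τ2 Rs with hT
  have hSGT : SG = T * Tᴴ := by rw [hSG, hG, hmodel.sigmaG_eq]
  have hS : (T * Tᴴ).PosSemidef := Matrix.posSemidef_self_mul_conjTranspose T
  have hs : (0 : ℝ) < σ2 := NNReal.coe_pos.2 hσ2
  have hlog2 : 0 < Real.log 2 := Real.log_pos one_lt_two
  -- All quantities depend on `X` through its law only.
  have htx : txGram μ X = txGram (μ.map X) fun x => x := by
    ext a b
    have hc : Continuous fun x : Blocks Nc Nx Nt => ((blkDiag x)ᴴ * blkDiag x) a b := by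
      have := continuous_blkDiag (Nc := Nc) (m := Nx) (n := Nt)
      exact (by fun_prop : Continuous fun x : Blocks Nc Nx Nt =>
        (blkDiag x)ᴴ * blkDiag x).matrix_elem a b
    simp only [txGram, Matrix.of_apply]
    rw [integral_map hX.aemeasurable hc.aestronglyMeasurable]
  set ρ := totalNoise (μ.map X) (T * Tᴴ) σ2 with hρdef
  have hρ : 0 < ρ := totalNoise_pos hXp hS hs
  have hRρ : R = (ρ : ℂ) • 1 := by
    rw [hR, interferenceCov, htx, hSGT, hρdef, coe_totalNoise hXp hS]
  have hSXρ : SX = sigmaX (μ.map X) fun x => x := by rw [hSX, sigmaX, htx, sigmaX]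
  have hcld : ∀ x : Blocks Nc Nx Nt,
      condLogDet x SG σ2 = Real.log (columnCov (T * Tᴴ) σ2 x).det.re / Real.log 2 := by
    intro x
    rw [hSGT]
    rfl
  have hcldint := integrable_log_det_columnCov hXp hS hs
  have hcld_comp : Integrable (fun ω => Real.log (columnCov (T * Tᴴ) σ2 (X ω)).det.re) μ :=
    (integrable_map_measure hcldint.aestronglyMeasurable hX.aemeasurable).1 hcldint
  have hcld_integral : ∫ x, Real.log (columnCov (T * Tᴴ) σ2 x).det.re ∂(μ.map X)
      = Real.log 2 * ∫ ω, condLogDet (X ω) SG σ2 ∂μ := by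
    rw [integral_map hX.aemeasurable hcldint.aestronglyMeasurable]
    simp only [hcld, integral_div]
    rw [mul_div_cancel₀ _ hlog2.ne']
  have hL : ∀ Hc : Blocks Nc Nt Nr, Real.log 2 * lowRate Nx Hc SX R
      = Nx * ∑ p, (Real.log (outputCov (μ.map X) ρ Hc p).det.re - Nr * Real.log ρ) := by
    intro Hc
    rw [hSXρ, hRρ, lowRate_eq hXp hρ, ← Finset.sum_div]
    field_simp
  have hL0 : ∀ Hc : Blocks Nc Nt Nr, 0 ≤ lowRate Nx Hc SX R := by
    intro Hc
    rw [hSXρ, hRρ]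
    exact lowRate_nonneg hXp hρ Hc
  have hdetR : ((1 : Matrix (Fin Nc) (Fin Nc) ℂ) ⊗ₖ R).det.re = ρ ^ (Nc * Nr) := by
    rw [hRρ, one_kronecker_smul_one, Matrix.det_smul, Matrix.det_one, mul_one, Fintype.card_prod,
      Fintype.card_fin, Fintype.card_fin, ← Complex.ofReal_pow, Complex.ofReal_re]
  set C : ℝ := (Nx : ℝ) * Real.logb 2 ((1 : Matrix (Fin Nc) (Fin Nc) ℂ) ⊗ₖ R).det.re
    - (Nr : ℝ) * ∫ ω, condLogDet (X ω) SG σ2 ∂μ with hC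
  have hupper : ∀ Hc : Blocks Nc Nt Nr,
      Nx * ∑ p, Real.log (outputCov (μ.map X) ρ Hc p).det.re
        - Nr * ∫ x, Real.log (columnCov (T * Tᴴ) σ2 x).det.re ∂(μ.map X)
      = Real.log 2 * (lowRate Nx Hc SX R + C) := by
    intro Hc
    rw [mul_add, hL, hcld_integral, hC, hdetR, Real.logb, Real.log_pow, Finset.sum_sub_distrib]
    simp only [Finset.sum_const, Finset.card_univ, Fintype.card_fin, nsmul_eq_mul, Nat.cast_mul]
    field_simp
    ring
  -- For the zero channel the rate vanishes, and the divergence bounded by `C` is nonnegative.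
  have hC0 : 0 ≤ C := by
    have h0 := (klDiv_jointLaw_le (T := T) hXp hσ2 (0 : Blocks Nc Nt Nr)).2
    have h1 : Real.log 2 * lowRate Nx (0 : Blocks Nc Nt Nr) SX R = 0 := by
      rw [hL]
      simp only [outputCov_zero, Matrix.det_smul, Matrix.det_one, mul_one, Fintype.card_fin,
        ← Complex.ofReal_pow, Complex.ofReal_re, Real.log_pow, sub_self, Finset.sum_const_zero,
        mul_zero]
    rw [← hρdef, hupper, mul_add, h1, zero_add] at h0
    exact nonneg_of_mul_nonneg_right h0 hlog2
  have hMI : condMutualInfo μ X Y H = ∫⁻ Hc, klDiv (jointLaw (μ.map X) T σ2 Hc)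
      ((μ.map X).prod (jointLaw (μ.map X) T σ2 Hc).snd) ∂(μ.map H) := by
    rw [hY, hH, hG]
    exact hmodel.condMutualInfo_eq Rs
  have hrate : Measurable fun Hc : Blocks Nc Nt Nr => ENNReal.ofReal (lowRate Nx Hc SX R) :=
    (measurable_lowRate SX R).ennreal_ofReal
  have hIlow' : Ilow = ∫⁻ Hc, ENNReal.ofReal (lowRate Nx Hc SX R) ∂(μ.map H) := by
    rw [hIlow, lintegral_map hrate hHm]
  have hlog2' : ENNReal.ofReal (Real.log 2) ≠ 0 := (ENNReal.ofReal_pos.2 hlog2).ne'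
  have hPH : IsProbabilityMeasure (μ.map H) := Measure.isProbabilityMeasure_map hHm.aemeasurable
  refine ⟨fun hgauss => ?_, ?_, ?_⟩
  · obtain ⟨Sg, hSg, hlaw⟩ := hgauss
    rw [condMutualInfoBits, ENNReal.le_div_iff_mul_le (.inl hlog2') (.inl ENNReal.ofReal_ne_top),
      hIlow', hMI, mul_comm, ← lintegral_const_mul _ hrate]
    refine lintegral_mono fun Hc => ?_
    rw [← ENNReal.ofReal_mul hlog2.le, hL]
    rcases eq_or_ne Nx 0 with h0 | h0
    · simp [h0]
    · exact le_klDiv_jointLaw hXp hlaw.map_eq hSg h0 hσ2 Hc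
  · simp only [hcld]
    exact hcld_comp.div_const _
  · have hle : condMutualInfoBits μ X Y H ≤ Ilow + ENNReal.ofReal C := by
      rw [condMutualInfoBits]
      refine ENNReal.div_le_of_le_mul ?_
      have hconst : Ilow + ENNReal.ofReal C = ∫⁻ Hc, (ENNReal.ofReal (lowRate Nx Hc SX R)
          + ENNReal.ofReal C) ∂(μ.map H) := by
        rw [lintegral_add_right _ measurable_const, ← hIlow', lintegral_const, measure_univ,
          mul_one]
      rw [hconst, mul_comm, ← lintegral_const_mul _ (hrate.add_const _), hMI]
      refine lintegral_mono fun Hc => ?_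
      refine (klDiv_jointLaw_le hXp hσ2 Hc).1.trans_eq ?_
      rw [← hρdef, hupper, ENNReal.ofReal_mul hlog2.le, ENNReal.ofReal_add (hL0 Hc) hC0]
    refine (EReal.coe_ennreal_le_coe_ennreal_iff.2 hle).trans_eq ?_
    rw [EReal.coe_ennreal_add, EReal.coe_ennreal_ofReal, max_eq_left hC0]
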